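/- Let $\mu_N\subset\mathbb C$ denote the group of $N$-th roots of unity, and let $\gamma$ be the Euler constant. For $\boldsymbol\eta=(\eta_1,\ldots,\eta_r)\in\mu_N^r$ and $\boldsymbol k=(k_1,\ldots,k_r)\in\mathbb Z_{>0}^r$ with $r\ge 0$, and for a positive integer $m$, put $$z_m(\boldsymbol\eta;\boldsymbol k;q)=\sum_{m>m_1>\cdots>m_r>0}\ \prod_{a=1}^r\frac{\eta_a^{m_a}}{[m_a]_q^{k_a}},\qquad L_m(\boldsymbol\eta;\boldsymbol k)=\sum_{m>m_1>\cdots>m_r>0}\ \prod_{a=1}^r\frac{\eta_a^{m_a}}{m_a^{k_a}},$$ where $[n]_q=1+q+\cdots+q^{n-1}$ (both sums are $1$ for $r=0$). Theorem. (i) For all $N\ge1$, $\boldsymbol k\in\mathbb Z_{>0}^r$ and $\boldsymbol\eta\in\mu_N^r$ there is a unique polynomial $L_*(\boldsymbol\eta;\boldsymbol k;T)\in\mathbb C[T]$ such that, for some positive integer $J$, $$L_m(\boldsymbol\eta;\boldsymbol k)=L_*(\boldsymbol\eta;\boldsymbol k;\log m+\gamma)+O\!\left(\frac{\log^J m}{m}\right)\qquad(m\to\infty).$$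 (ii) For every $\boldsymbol k=(k_1,\ldots,k_r)\in\mathbb Z_{>0}^r$ there is a positive integer $J$, depending only on $\boldsymbol k$, such that for every $N\ge1$ and every $\boldsymbol\eta=(\eta_1,\ldots,\eta_r)\in\mu_N^r$, as $m\to\infty$, $$\begin{aligned}z_m\bigl(\boldsymbol\eta;\boldsymbol k;e^{2\pi i/m}\bigr)=\sum_{j=0}^r(-1)^{k_1+\cdots+k_j}(\eta_1\cdots\eta_j)^m\;&L_*\!\left(\overline{\eta}_j,\ldots,\overline{\eta}_1;\,k_j,\ldots,k_1;\,\log\tfrac m\pi+\gamma+\tfrac{\pi i}2\right)\\ \times\;&L_*\!\left(\eta_{j+1},\ldots,\eta_r;\,k_{j+1},\ldots,k_r;\,\log\tfrac m\pi+\gamma-\tfrac{\pi i}2\right)+O\!\left(\frac{\log^J m}{m}\right),\end{aligned}$$ where the implied constant may depend on $\boldsymbol\eta$ and $\boldsymbol k$. -/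

import Mathlib

noncomputable section

namespace ColoredMZV

/-- Indices of depth `r` are lists `[(η₁, k₁), …, (η_r, k_r)]`; the empty list is the empty index. -/
abbrev Index : Type := List (ℂ × ℕ)

/-- The index with entries `η₁, …, η_r` and `k₁, …, k_r`. -/
def mkIndex {r : ℕ} (η : Fin r → ℂ) (k : Fin r → ℕ) : Index :=
  List.ofFn fun i => (η i, k i)

/-- For a sequence `b` of "integers", the nested sum
`∑_{m > m₁ > ⋯ > m_r > 0} ∏_j η_j ^ m_j / (b m_j) ^ k_j`, summed over `m₁` first;
the empty index gives `1`. -/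
def nestedSum (b : ℕ → ℂ) : Index → ℕ → ℂ
  | [], _ => 1
  | (η, k) :: w, m => ∑ n ∈ Finset.Ioo 0 m, η ^ n / b n ^ k * nestedSum b w n

/-- The `q`-integer `[n]_q = 1 + q + ⋯ + q ^ (n - 1)`. -/
def qInt (q : ℂ) (n : ℕ) : ℂ := ∑ i ∈ Finset.range n, q ^ i

/-- The multiple harmonic `q`-sum
`z_m(w; q) = ∑_{m > m₁ > ⋯ > m_r > 0} ∏_j η_j ^ m_j / [m_j]_q ^ k_j`. -/
def multHarmonicQSum (w : Index) (m : ℕ) (q : ℂ) : ℂ := nestedSum (qInt q) w m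

/-- The truncated colored multiple zeta value
`L_m(w) = ∑_{m > m₁ > ⋯ > m_r > 0} ∏_j η_j ^ m_j / m_j ^ k_j`. -/
def truncL (w : Index) (m : ℕ) : ℂ := nestedSum (fun n => (n : ℂ)) w m

/-- `P` is a harmonic regularized polynomial of `w`:
`L_m(w) = P(log m + γ) + O(log ^ J m / m)` as `m → ∞` for some positive integer `J`. -/
def IsHarmonicReg (w : Index) (P : Polynomial ℂ) : Prop :=
  ∃ J : ℕ, 0 < J ∧
    (fun m : ℕ => truncL w m - P.eval ((Real.log m : ℂ) + (Real.eulerMascheroniConstant : ℂ)))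
      =O[Filter.atTop] (fun m : ℕ => Real.log m ^ J / (m : ℝ))

open Classical in
/-- The harmonic regularized polynomial `L_*(w; T)`, i.e. the polynomial `P` with
`IsHarmonicReg w P` (with the value `0` only if there were none). -/
def Lstar (w : Index) : Polynomial ℂ :=
  if h : ∃ P : Polynomial ℂ, IsHarmonicReg w P then h.choose else 0

/-- Reverse an index and conjugate its roots of unity:
`(η₁, …, η_j; k₁, …, k_j) ↦ (conj η_j, …, conj η₁; k_j, …, k₁)`. -/
def conjReverse (w : Index) : Index :=
  w.reverse.map fun p => (starRingEnd ℂ p.1, p.2)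

/-- The main term of the asymptotic formula:
`∑_{j=0}^r (-1)^(k₁+⋯+k_j) (η₁⋯η_j)^m`
`  · L_*(conj η_j, …, conj η₁; k_j, …, k₁; log (m/π) + γ + πi/2)`
`  · L_*(η_{j+1}, …, η_r; k_{j+1}, …, k_r; log (m/π) + γ - πi/2)`. -/
def mainTerm (w : Index) (m : ℕ) : ℂ :=
  ∑ j ∈ Finset.range (w.length + 1),
    (-1 : ℂ) ^ ((w.take j).map Prod.snd).sum * ((w.take j).map Prod.fst).prod ^ m
      * (Lstar (conjReverse (w.take j))).eval
          ((Real.log (m / Real.pi) : ℂ) + (Real.eulerMascheroniConstant : ℂ)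
            + (Real.pi : ℂ) * Complex.I / 2)
      * (Lstar (w.drop j)).eval
          ((Real.log (m / Real.pi) : ℂ) + (Real.eulerMascheroniConstant : ℂ)
            - (Real.pi : ℂ) * Complex.I / 2)

end ColoredMZV

end

/-! Cut the q-sum at about `m / 2` and sort the chains `m₁ > ⋯ > m_r` by the number `j` of entries
above the cut. For `q = e ^ (2πi / m)` the substitution `n ↦ m - n` turns `[n]_q` into `-q⁻¹` times
the conjugate of `[n]_q`. So the upper entries give, up to the factor `(-1) ^ (k₁ + ⋯ + k_j)
(η₁⋯η_j) ^ m` and a power of `q` that tends to `1`, the conjugate of a q-sum over the reversed index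
with all entries below about `m / 2` (`multHarmonicQSum_split`).

It remains to treat such half sums. With `h = π / m`, `1 / [n]_q = e ^ (ih) sin h (cot (nh) - i)`,
which is within `O(1/m)` of `1 / n` when `n ≤ m / 2`. If the first letter is not `(1, 1)`, this
suffices: the half sum and the ordinary truncated sum have the same limit, up to `O(log ^ r m / m)`
(`exists_closeStrong`, `exists_truncL_limit`). For the single letter `(1, 1)`, the harmonic sum
gives `log (m / 2) + γ`, a Riemann sum for `cot x - 1 / x` on `(0, π / 2]` gives `log (2 / π)`, and
the `-i` terms give `-πi / 2` (`exists_norm_sum_inv_qInt_sub_le`).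

Harmonic multiplication by `(1, 1)` holds verbatim for both kinds of sums, so it removes leading
letters `(1, 1)` from both at once. One polynomial therefore describes the truncated sum at `log m +
γ` and the half sum at `log (m / π) + γ - πi / 2` (`exists_jointReg`). Uniqueness identifies it with
`Lstar`. -/

noncomputable section

namespace ColoredMZV

open Finset Filter Topology Asymptotics

/-! ### Iterated sums: splitting and reflection -/

/-- Iterated sum `∑_{b > n₁ > ⋯ > n_r ≥ a} ∏ f_i n_i`. -/
def itSum : List (ℕ → ℂ) → ℕ → ℕ → ℂ
  | [], _, _ => 1
  | f :: fs, a, b => ∑ n ∈ Ico a b, f n * itSum fs a n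

/-- The summand attached to a letter. -/
def letterFun (b : ℕ → ℂ) (p : ℂ × ℕ) (n : ℕ) : ℂ := p.1 ^ n / b n ^ p.2

theorem nestedSum_eq_itSum (b : ℕ → ℂ) (w : Index) (m : ℕ) :
    nestedSum b w m = itSum (w.map (letterFun b)) 1 m := by
  induction w generalizing m with
  | nil => rfl
  | cons p w ih =>
    obtain ⟨η, k⟩ := p
    simp only [nestedSum, itSum, List.map_cons, letterFun]
    exact Finset.sum_congr (by ext; simp [Nat.succ_le_iff]) fun n _ => by rw [ih]

/-- The chains are sorted by the number `j` of entries that are at least `c`; since the entries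
decrease, these are the first `j`. The induction peels off the largest entry: if it lies below `c`,
then `j = 0`. -/
theorem itSum_split (fs : List (ℕ → ℂ)) {a c b : ℕ} (hac : a ≤ c) (hcb : c ≤ b) :
    itSum fs a b = ∑ j ∈ range (fs.length + 1),
      itSum (fs.take j) c b * itSum (fs.drop j) a c := by
  induction fs generalizing b with
  | nil => simp [itSum]
  | cons f fs ih =>
    rw [List.length_cons, Finset.sum_range_succ']
    simp only [List.take_succ_cons, List.drop_succ_cons, List.take_zero, List.drop_zero, itSum,
      one_mul]
    rw [← Finset.sum_Ico_consecutive _ hac hcb, add_comm]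
    congr 1
    simp only [Finset.sum_mul]
    rw [Finset.sum_comm]
    refine Finset.sum_congr rfl fun n hn => ?_
    rw [ih (Finset.mem_Ico.1 hn).1, Finset.mul_sum]
    exact Finset.sum_congr rfl fun j _ => by ring

theorem itSum_append_singleton (fs : List (ℕ → ℂ)) (g : ℕ → ℂ) (a b : ℕ) :
    itSum (fs ++ [g]) a b = ∑ n ∈ Ico a b, g n * itSum fs (n + 1) b := by
  induction fs generalizing b with
  | nil => simp [itSum]
  | cons f fs ih =>
    simp only [List.cons_append, itSum, ih, Finset.mul_sum]
    rw [Finset.sum_comm' (t' := Ico a b) (s' := fun n => Ico (n + 1) b)]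
    · exact Finset.sum_congr rfl fun n _ => Finset.sum_congr rfl fun p _ => by ring
    · intro x y; simp only [Finset.mem_Ico]; omega

/-- Reflection reverses the order of a chain, hence the order of the letters. The bound on `b` keeps
every entry at most `m`, so that the truncated subtraction is an involution. -/
theorem itSum_reflect (fs : List (ℕ → ℂ)) {a b m : ℕ} (hb : b ≤ m + 1) :
    itSum (fs.map fun f n => f (m - n)).reverse (m + 1 - b) (m + 1 - a) = itSum fs a b := by
  induction fs generalizing b with
  | nil => simp [itSum]
  | cons f fs ih =>
    rw [List.map_cons, List.reverse_cons, itSum_append_singleton]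
    simp only [itSum]
    refine Finset.sum_nbij' (fun n => m - n) (fun n => m - n) ?_ ?_ ?_ ?_ ?_
    · intro n hn; simp only [Finset.mem_Ico] at *; omega
    · intro n hn; simp only [Finset.mem_Ico] at *; omega
    · intro n hn; simp only [Finset.mem_Ico] at *; omega
    · intro n hn; simp only [Finset.mem_Ico] at *; omega
    · intro n hn
      simp only [Finset.mem_Ico] at hn
      rw [← ih (b := m - n) (by omega)]
      congr 3
      omega

theorem itSum_map_scale {α : Type*} (l : List α) (F G : α → ℕ → ℂ) (s : α → ℂ) {a b : ℕ}
    (h : ∀ p ∈ l, ∀ n ∈ Ico a b, F p n = s p * starRingEnd ℂ (G p n)) :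
    itSum (l.map F) a b = (l.map s).prod * starRingEnd ℂ (itSum (l.map G) a b) := by
  induction l generalizing b with
  | nil => simp [itSum]
  | cons p l ih =>
    simp only [List.map_cons, itSum, List.prod_cons, map_sum, map_mul, Finset.mul_sum]
    refine Finset.sum_congr rfl fun n hn => ?_
    rw [h p (by simp) n hn, ih fun p' hp' n' hn' => h p' (by simp [hp']) n' ?_]
    · ring
    · simp only [Finset.mem_Ico] at *; omega

/-! ### The harmonic product with the letter `(1, 1)` -/

theorem sum_Ioo_succ {M : Type*} [AddCommMonoid M] (f : ℕ → M) {n : ℕ} (hn : 0 < n) :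
    ∑ i ∈ Ioo 0 (n + 1), f i = ∑ i ∈ Ioo 0 n, f i + f n := by
  have : Ioo 0 (n + 1) = insert n (Ioo 0 n) := by ext; simp; omega
  rw [this, Finset.sum_insert (by simp), add_comm]

theorem nestedSum_cons (b : ℕ → ℂ) (p : ℂ × ℕ) (w : Index) (m : ℕ) :
    nestedSum b (p :: w) m = ∑ n ∈ Ioo 0 m, letterFun b p n * nestedSum b w n := rfl

theorem nestedSum_cons_succ (b : ℕ → ℂ) (p : ℂ × ℕ) (w : Index) {n : ℕ} (hn : 0 < n) :
    nestedSum b (p :: w) (n + 1) =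
      nestedSum b (p :: w) n + letterFun b p n * nestedSum b w n := by
  rw [nestedSum_cons, sum_Ioo_succ _ hn, nestedSum_cons]

theorem sum_Ioo_mul_sum_Ioo (a c : ℕ → ℂ) (m : ℕ) :
    (∑ i ∈ Ioo 0 m, a i) * ∑ n ∈ Ioo 0 m, c n =
      ∑ i ∈ Ioo 0 m, a i * ∑ n ∈ Ioo 0 i, c n + ∑ n ∈ Ioo 0 m, a n * c n
        + ∑ n ∈ Ioo 0 m, c n * ∑ i ∈ Ioo 0 n, a i := by
  induction m with
  | zero => simp
  | succ m ih =>
    rcases Nat.eq_zero_or_pos m with rfl | hm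
    · simp [show Ioo 0 1 = (∅ : Finset ℕ) from rfl]
    · simp only [sum_Ioo_succ _ hm]
      linear_combination ih

/-- The words in the harmonic product of the letter `(1, 1)` with a word. -/
def stuffleOne : Index → List Index
  | [] => [[(1, 1)]]
  | (η, k) :: w => ((1, 1) :: (η, k) :: w) :: ((η, k + 1) :: w) ::
      (stuffleOne w).map ((η, k) :: ·)

theorem sum_map_nestedSum_cons (b : ℕ → ℂ) (p : ℂ × ℕ) (l : List Index) (m : ℕ) :
    ((l.map (p :: ·)).map fun v => nestedSum b v m).sum =
      ∑ n ∈ Ioo 0 m, letterFun b p n * (l.map fun v => nestedSum b v n).sum := by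
  induction l with
  | nil => simp
  | cons v l ih =>
    simp only [List.map_cons, List.sum_cons, ih, nestedSum_cons, mul_add, Finset.sum_add_distrib]

/-- The new variable is larger than, equal to or smaller than the first variable of `w`; the last
case recurses. Nothing is used about `b`, so the same relation serves integers and q-integers. -/
theorem nestedSum_one_mul (b : ℕ → ℂ) (w : Index) (m : ℕ) :
    nestedSum b [(1, 1)] m * nestedSum b w m =
      ((stuffleOne w).map fun v => nestedSum b v m).sum := by
  induction w generalizing m with
  | nil => simp [stuffleOne, nestedSum]
  | cons p w ih =>
    obtain ⟨η, k⟩ := p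
    simp only [stuffleOne, List.map_cons, List.sum_cons]
    rw [sum_map_nestedSum_cons]
    simp only [← ih]
    rw [nestedSum_cons b (1, 1), nestedSum_cons b (η, k), sum_Ioo_mul_sum_Ioo, add_assoc,
      nestedSum_cons b (1, 1), nestedSum_cons b (η, k + 1)]
    congr 1
    · simp [nestedSum, letterFun]
    congr 1
    · refine Finset.sum_congr rfl fun n _ => ?_
      simp only [nestedSum, letterFun, one_pow, mul_one, pow_succ]
      rw [one_div, div_eq_mul_inv, div_eq_mul_inv, mul_inv]
      ring
    · refine Finset.sum_congr rfl fun n _ => ?_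
      rw [nestedSum_cons b (1, 1)]
      ring

/-! ### Conjugation and the symmetry of q-integers at roots of unity -/

theorem conj_nestedSum (b : ℕ → ℂ) (w : Index) (m : ℕ) :
    starRingEnd ℂ (nestedSum b w m) =
      nestedSum (fun n => starRingEnd ℂ (b n)) (w.map fun p => (starRingEnd ℂ p.1, p.2)) m := by
  induction w generalizing m with
  | nil => simp [nestedSum]
  | cons p w ih => simp [nestedSum_cons, letterFun, ih]

theorem conj_truncL (w : Index) (m : ℕ) :
    starRingEnd ℂ (truncL w m) = truncL (w.map fun p => (starRingEnd ℂ p.1, p.2)) m := by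
  simp [truncL, conj_nestedSum]

theorem qInt_eq {q : ℂ} (hq : q ≠ 1) (n : ℕ) : qInt q n = (q ^ n - 1) / (q - 1) :=
  geom_sum_eq hq n

/-- Here `q ^ (m - n) = q⁻ⁿ` is the conjugate of `q ^ n`, so only the denominators `q - 1` and `q⁻¹
- 1` differ, and their ratio produces `-q⁻¹`. -/
theorem qInt_reflect {q : ℂ} {m n : ℕ} (hq1 : q ≠ 1) (hqm : q ^ m = 1) (hqn : ‖q‖ = 1)
    (hn : n ≤ m) : qInt q (m - n) = -q⁻¹ * starRingEnd ℂ (qInt q n) := by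
  have hq0 : q ≠ 0 := by rintro rfl; simp at hqn
  have hc : starRingEnd ℂ q = q⁻¹ := (Complex.inv_eq_conj hqn).symm
  have h1 : q - 1 ≠ 0 := sub_ne_zero.2 hq1
  have h2 : 1 - q ≠ 0 := sub_ne_zero.2 hq1.symm
  have hqi : q⁻¹ - 1 ≠ 0 := by
    rw [sub_ne_zero]; simpa using hq1
  have h3 : q ^ (m - n) = (q ^ n)⁻¹ := by
    exact eq_inv_of_mul_eq_one_left (by rw [← pow_add, Nat.sub_add_cancel hn, hqm])
  rw [qInt_eq hq1, qInt_eq hq1, h3]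
  simp only [map_div₀, map_sub, map_pow, hc, map_one, inv_pow]
  have h4 : q⁻¹ - 1 = (1 - q) * q⁻¹ := by field_simp
  rw [h4]
  field_simp
  ring

theorem letterFun_qInt_reflect {q : ℂ} {m n : ℕ} (hq1 : q ≠ 1) (hqm : q ^ m = 1) (hqn : ‖q‖ = 1)
    (hn : n ≤ m) {p : ℂ × ℕ} (hp : ‖p.1‖ = 1) :
    letterFun (qInt q) p (m - n) =
      (p.1 ^ m * (-q) ^ p.2) * starRingEnd ℂ (letterFun (qInt q) p n) := by
  have hq0 : q ≠ 0 := by rintro rfl; simp at hqn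
  have hp0 : p.1 ≠ 0 := by intro h; simp [h] at hp
  have hc : starRingEnd ℂ p.1 = p.1⁻¹ := (Complex.inv_eq_conj hp).symm
  have h3 : p.1 ^ (m - n) = p.1 ^ m * (p.1 ^ n)⁻¹ := by
    rw [eq_mul_inv_iff_mul_eq₀ (pow_ne_zero _ hp0), ← pow_add, Nat.sub_add_cancel hn]
  have h5 : -q⁻¹ = (-q)⁻¹ := by rw [inv_neg]
  simp only [letterFun, qInt_reflect hq1 hqm hqn hn, h3, div_eq_mul_inv, map_mul, map_inv₀, map_pow,
    hc, h5, mul_pow, inv_pow, mul_inv, inv_inv]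
  ring

/-- The block of entries in `[c, m)` is reflected onto `[1, m + 1 - c)`. The scalars picked up by
its letters do not depend on the summation variables and leave the sum. -/
theorem multHarmonicQSum_split {q : ℂ} {m c : ℕ} (hq1 : q ≠ 1) (hqm : q ^ m = 1) (hqn : ‖q‖ = 1)
    (hc : 1 ≤ c) (hcm : c ≤ m) (w : Index) (hw : ∀ p ∈ w, ‖p.1‖ = 1) :
    multHarmonicQSum w m q = ∑ j ∈ range (w.length + 1),
      (-1 : ℂ) ^ ((w.take j).map Prod.snd).sum * ((w.take j).map Prod.fst).prod ^ m
        * q ^ ((w.take j).map Prod.snd).sum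
        * starRingEnd ℂ (nestedSum (qInt q) (w.take j).reverse (m + 1 - c))
        * nestedSum (qInt q) (w.drop j) c := by
  rw [multHarmonicQSum, nestedSum_eq_itSum, itSum_split _ hc hcm, List.length_map]
  refine Finset.sum_congr rfl fun j _ => ?_
  rw [← List.map_take, ← List.map_drop, ← nestedSum_eq_itSum]
  congr 1
  have hw' : ∀ p ∈ w.take j, ‖p.1‖ = 1 := fun p hp => hw p (List.mem_of_mem_take hp)
  generalize w.take j = v at hw'
  rw [← itSum_reflect (m := m) _ (Nat.le_succ m), List.map_map, ← List.map_reverse,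
    show m + 1 - m = 1 by omega,
    itSum_map_scale (G := letterFun (qInt q)) (s := fun p => p.1 ^ m * (-q) ^ p.2),
    ← nestedSum_eq_itSum]
  · congr 1
    rw [List.map_reverse, (List.reverse_perm _).prod_eq]
    clear hw'
    induction v with
    | nil => simp
    | cons p v ih =>
      simp only [List.map_cons, List.prod_cons, List.sum_cons, ih]
      rw [neg_pow q, pow_add, pow_add, mul_pow]
      ring
  · intro p hp n hn
    exact letterFun_qInt_reflect hq1 hqm hqn (by simp only [Finset.mem_Ico] at hn; omega)
      (hw' p (by simpa using hp))

/-! ### Logarithmic bounds for nested sums -/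

/-- The logarithmic scale `1 + log n`. -/
def lam (n : ℕ) : ℝ := 1 + Real.log n

theorem one_le_lam (n : ℕ) : 1 ≤ lam n := by
  have := Real.log_natCast_nonneg n
  unfold lam; linarith

theorem lam_pos (n : ℕ) : 0 < lam n := zero_lt_one.trans_le (one_le_lam n)

theorem lam_mono {n m : ℕ} (h : n ≤ m) : lam n ≤ lam m := by
  unfold lam
  rcases Nat.eq_zero_or_pos n with rfl | hn
  · simpa using Real.log_natCast_nonneg m
  · have := Real.log_le_log (by exact_mod_cast hn) (show (n : ℝ) ≤ m by exact_mod_cast h)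
    linarith

theorem sum_Ioo_inv_le (n : ℕ) : ∑ i ∈ Ioo 0 n, (i : ℝ)⁻¹ ≤ lam n := by
  have h := harmonic_le_one_add_log n
  rw [harmonic_eq_sum_Icc] at h
  push_cast at h
  refine le_trans (Finset.sum_le_sum_of_subset_of_nonneg ?_ fun _ _ _ => by positivity) h
  intro i; simp only [Finset.mem_Ioo, Finset.mem_Icc]; omega

/-- All roots in the index have modulus one and all exponents are positive. -/
def Valid (w : Index) : Prop := ∀ p ∈ w, ‖p.1‖ = 1 ∧ 0 < p.2

theorem valid_cons {p : ℂ × ℕ} {w : Index} :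
    Valid (p :: w) ↔ (‖p.1‖ = 1 ∧ 0 < p.2) ∧ Valid w := by
  simp [Valid]

theorem norm_letterFun (b : ℕ → ℂ) {p : ℂ × ℕ} (hp : ‖p.1‖ = 1) (n : ℕ) :
    ‖letterFun b p n‖ = ‖(b n)⁻¹‖ ^ p.2 := by
  simp [letterFun, hp, div_eq_mul_inv]

theorem div_pow_le_div {A x : ℝ} (hA : 0 ≤ A) (hx : 1 ≤ x) {k : ℕ} (hk : 0 < k) :
    (A / x) ^ k ≤ A ^ k / x := by
  rw [div_pow]
  exact div_le_div_of_nonneg_left (pow_nonneg hA _) (by linarith)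
    (le_self_pow₀ hx hk.ne')

theorem norm_letterFun_le {b : ℕ → ℂ} {p : ℂ × ℕ} (hp : ‖p.1‖ = 1 ∧ 0 < p.2) {A : ℝ} (hA : 0 ≤ A)
    {n : ℕ} (hn : 0 < n) (hb : ‖(b n)⁻¹‖ ≤ A / n) : ‖letterFun b p n‖ ≤ A ^ p.2 / n := by
  rw [norm_letterFun b hp.1]
  exact (pow_le_pow_left₀ (norm_nonneg _) hb _).trans
    (div_pow_le_div hA (by exact_mod_cast hn) hp.2)

/-- Each summation costs one harmonic sum, hence one factor `lam n`; a letter of weight `k`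
contributes `A ^ k`. -/
theorem norm_nestedSum_le {b : ℕ → ℂ} {A : ℝ} (hA : 0 ≤ A) {w : Index} (hw : Valid w) {n : ℕ}
    (hb : ∀ i, 0 < i → i < n → ‖(b i)⁻¹‖ ≤ A / i) :
    ‖nestedSum b w n‖ ≤ A ^ (w.map Prod.snd).sum * lam n ^ w.length := by
  induction w generalizing n with
  | nil => simp [nestedSum]
  | cons p w ih =>
    rw [valid_cons] at hw
    rw [nestedSum_cons]
    have hterm : ∀ i ∈ Ioo 0 n, ‖letterFun b p i * nestedSum b w i‖ ≤
        A ^ ((p :: w).map Prod.snd).sum * lam n ^ w.length * (i : ℝ)⁻¹ := by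
      intro i hi
      rw [Finset.mem_Ioo] at hi
      rw [norm_mul]
      have h1 := norm_letterFun_le hw.1 hA hi.1 (hb i hi.1 hi.2)
      have h2 := ih hw.2 (n := i) fun j hj hj' => hb j hj (hj'.trans hi.2)
      have h3 : lam i ^ w.length ≤ lam n ^ w.length :=
        pow_le_pow_left₀ (lam_pos i).le (lam_mono hi.2.le) _
      calc ‖letterFun b p i‖ * ‖nestedSum b w i‖
          ≤ A ^ p.2 / i * (A ^ (w.map Prod.snd).sum * lam n ^ w.length) := by
            refine mul_le_mul h1 (h2.trans ?_) (norm_nonneg _) (by positivity)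
            gcongr
        _ = _ := by rw [List.map_cons, List.sum_cons, pow_add]; ring
    refine (norm_sum_le_of_le _ hterm).trans ?_
    rw [← Finset.mul_sum, List.length_cons, pow_succ, ← mul_assoc]
    have := lam_pos n
    gcongr
    exact sum_Ioo_inv_le n

theorem norm_truncL_le {w : Index} (hw : Valid w) (n : ℕ) :
    ‖truncL w n‖ ≤ lam n ^ w.length := by
  have := norm_nestedSum_le (b := fun n => (n : ℂ)) (A := 1) zero_le_one hw (n := n)
    fun i _ _ => by simp
  simpa [truncL] using this

/-! ### Comparing nested sums over `b` and over the integers -/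

/-- The sequence `b` is close to `n ↦ n` up to `m / 2`. -/
structure Approx (C : ℝ) (m : ℕ) (b : ℕ → ℂ) : Prop where
  near : ∀ n, 0 < n → 2 * n ≤ m → ‖(b n)⁻¹ - (n : ℂ)⁻¹‖ ≤ C / m
  near_succ : ∀ n, 0 < n → 2 * (n + 1) ≤ m →
    ‖((b n)⁻¹ - (n : ℂ)⁻¹) - ((b (n + 1))⁻¹ - ((n + 1 : ℕ) : ℂ)⁻¹)‖ ≤ C / (m * n)

theorem Approx.inv_le {C : ℝ} {m : ℕ} {b : ℕ → ℂ} (h : Approx C m b) (hC : 0 ≤ C) {n : ℕ}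
    (hn : 0 < n) (hnm : 2 * n ≤ m) : ‖(b n)⁻¹‖ ≤ (1 + C) / n := by
  have hn' : (0 : ℝ) < n := by exact_mod_cast hn
  have h1 : C / m ≤ C / n :=
    div_le_div_of_nonneg_left hC hn' (by exact_mod_cast (by omega : n ≤ m))
  calc ‖(b n)⁻¹‖ = ‖((b n)⁻¹ - (n : ℂ)⁻¹) + (n : ℂ)⁻¹‖ := by rw [sub_add_cancel]
    _ ≤ ‖(b n)⁻¹ - (n : ℂ)⁻¹‖ + ‖(n : ℂ)⁻¹‖ := norm_add_le _ _
    _ ≤ C / n + 1 / n := by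
      refine add_le_add ((h.near n hn hnm).trans h1) ?_
      simp
    _ = _ := by ring

theorem Approx.norm_nestedSum_le {C : ℝ} {m : ℕ} {b : ℕ → ℂ} (h : Approx C m b) (hC : 0 ≤ C)
    {w : Index} (hw : Valid w) {n : ℕ} (hnm : 2 * n ≤ m + 2) :
    ‖nestedSum b w n‖ ≤ (1 + C) ^ (w.map Prod.snd).sum * lam n ^ w.length :=
  ColoredMZV.norm_nestedSum_le (by linarith) hw fun i hi hin => h.inv_le hC hi (by omega)

theorem exists_norm_pow_sub_pow_le (C : ℝ) (hC : 0 ≤ C) (k : ℕ) :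
    ∃ K, 0 ≤ K ∧ ∀ (u v : ℂ) (x y : ℝ), 0 < x → 0 < y → ‖u‖ ≤ (1 + C) / x → ‖v‖ ≤ 1 / x →
      ‖u - v‖ ≤ C / y → ‖u ^ (k + 1) - v ^ (k + 1)‖ ≤ K / (y * x ^ k) := by
  induction k with
  | zero => exact ⟨C, hC, fun u v x y _ _ _ _ h => by simpa using h⟩
  | succ k ih =>
    obtain ⟨K, hK, ih⟩ := ih
    refine ⟨(1 + C) ^ (k + 1) * C + K, by positivity, fun u v x y hx hy hu hv huv => ?_⟩
    have e : u ^ (k + 1 + 1) - v ^ (k + 1 + 1) =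
        u ^ (k + 1) * (u - v) + v * (u ^ (k + 1) - v ^ (k + 1)) := by ring
    rw [e]
    refine (norm_add_le _ _).trans ?_
    rw [norm_mul, norm_mul, norm_pow]
    calc ‖u‖ ^ (k + 1) * ‖u - v‖ + ‖v‖ * ‖u ^ (k + 1) - v ^ (k + 1)‖
        ≤ ((1 + C) / x) ^ (k + 1) * (C / y) + 1 / x * (K / (y * x ^ k)) := by
          have := ih u v x y hx hy hu hv huv
          gcongr
      _ = _ := by rw [div_pow, pow_succ x]; field_simp

theorem exists_norm_letterFun_sub_le (C : ℝ) (hC : 0 ≤ C) {p : ℂ × ℕ} (hp : ‖p.1‖ = 1 ∧ 0 < p.2) :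
    ∃ K, 0 ≤ K ∧ ∀ m b, Approx C m b → ∀ n, 0 < n → 2 * n ≤ m →
      ‖letterFun b p n - letterFun (fun n => (n : ℂ)) p n‖ ≤ K / (m * (n : ℝ) ^ (p.2 - 1)) := by
  obtain ⟨K, hK, h⟩ := exists_norm_pow_sub_pow_le C hC (p.2 - 1)
  refine ⟨K, hK, fun m b hb n hn hnm => ?_⟩
  have h1 := h (b n)⁻¹ (n : ℂ)⁻¹ n m (by exact_mod_cast hn)
    (by exact_mod_cast (by omega : 0 < m)) (hb.inv_le hC hn hnm) (by simp) (hb.near n hn hnm)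
  rw [Nat.sub_add_cancel hp.2] at h1
  have e : letterFun b p n - letterFun (fun n => (n : ℂ)) p n =
      p.1 ^ n * ((b n)⁻¹ ^ p.2 - (n : ℂ)⁻¹ ^ p.2) := by
    simp only [letterFun, div_eq_mul_inv, inv_pow]; ring
  rw [e, norm_mul, norm_pow, hp.1, one_pow, one_mul]
  exact h1

/-- `K` is a constant for the comparison of the nested sums of `w` over `b` and over `n ↦ n`. -/
def Close (C K : ℝ) (w : Index) : Prop :=
  ∀ m b, Approx C m b → ∀ n, 0 < n → 2 * n ≤ m + 2 →
    ‖nestedSum b w n - truncL w n‖ ≤ K * lam m ^ w.length * n / m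

/-- The error of the tail carries a factor `n / m`, and the letter in front supplies `1 / n ^ k`.
The product has the same size as the error of the letter itself. -/
theorem Close.exists_term_le {C K : ℝ} (hC : 0 ≤ C) (hK : 0 ≤ K) {p : ℂ × ℕ} {w : Index}
    (hw : Valid (p :: w)) (h : Close C K w) :
    ∃ K', 0 ≤ K' ∧ ∀ m b, Approx C m b → ∀ n, 0 < n → 2 * n ≤ m →
      ‖letterFun b p n * nestedSum b w n - letterFun (fun n => (n : ℂ)) p n * truncL w n‖ ≤
        K' * lam m ^ w.length / (m * (n : ℝ) ^ (p.2 - 1)) := by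
  rw [valid_cons] at hw
  obtain ⟨K₁, hK₁, h₁⟩ := exists_norm_letterFun_sub_le C hC hw.1
  refine ⟨K₁ * (1 + C) ^ (w.map Prod.snd).sum + K, by positivity, fun m b hb n hn hnm => ?_⟩
  have hm : (0 : ℝ) < m := by exact_mod_cast (by omega : 0 < m)
  have hn' : (0 : ℝ) < n := by exact_mod_cast hn
  have e : letterFun b p n * nestedSum b w n - letterFun (fun n => (n : ℂ)) p n * truncL w n =
      (letterFun b p n - letterFun (fun n => (n : ℂ)) p n) * nestedSum b w n +
        letterFun (fun n => (n : ℂ)) p n * (nestedSum b w n - truncL w n) := by ring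
  rw [e]
  refine (norm_add_le _ _).trans ?_
  rw [norm_mul, norm_mul, norm_letterFun _ hw.1.1]
  have h2 := hb.norm_nestedSum_le hC hw.2 (n := n) (by omega)
  have h3 : lam n ^ w.length ≤ lam m ^ w.length :=
    pow_le_pow_left₀ (lam_pos n).le (lam_mono (by omega)) _
  have h4 := h m b hb n hn (by omega)
  have h5 := h₁ m b hb n hn hnm
  have h6 : ‖((n : ℂ))⁻¹‖ ^ p.2 = 1 / ((n : ℝ) ^ (p.2 - 1) * n) := by
    rw [← pow_succ, Nat.sub_add_cancel hw.1.2]; simp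
  have hl := lam_pos m
  calc _ ≤ K₁ / (m * (n : ℝ) ^ (p.2 - 1)) *
          ((1 + C) ^ (w.map Prod.snd).sum * lam m ^ w.length)
        + 1 / ((n : ℝ) ^ (p.2 - 1) * n) * (K * lam m ^ w.length * n / m) := by
          rw [h6]
          refine add_le_add (mul_le_mul h5 (h2.trans ?_) (norm_nonneg _) (by positivity)) ?_
          · gcongr
          · gcongr
    _ = _ := by field_simp

/-- A crude bound: each of fewer than `n` terms errs by a power of `lam m` over `m`. It does not
tend to zero for `n` near `m / 2`, but it is enough for the tail of a word. -/
theorem exists_close (C : ℝ) (hC : 0 ≤ C) {w : Index} (hw : Valid w) :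
    ∃ K, 0 ≤ K ∧ Close C K w := by
  induction w with
  | nil => exact ⟨0, le_rfl, fun m b _ n _ _ => by simp [nestedSum, truncL]⟩
  | cons p w ih =>
    obtain ⟨K, hK, h⟩ := ih (valid_cons.1 hw).2
    obtain ⟨K', hK', h'⟩ := h.exists_term_le hC hK hw
    refine ⟨K', hK', fun m b hb n hn hnm => ?_⟩
    rw [nestedSum_cons, truncL, nestedSum_cons, ← Finset.sum_sub_distrib]
    have hl := one_le_lam m
    have hterm : ∀ i ∈ Ioo 0 n, ‖letterFun b p i * nestedSum b w i -
        letterFun (fun n => (n : ℂ)) p i * nestedSum (fun n => (n : ℂ)) w i‖ ≤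
        K' * lam m ^ (w.length + 1) / m := by
      intro i hi
      rw [Finset.mem_Ioo] at hi
      have hm : (0 : ℝ) < m := by exact_mod_cast (by omega : 0 < m)
      have hi1 : (1 : ℝ) ≤ (i : ℝ) ^ (p.2 - 1) := one_le_pow₀ (by exact_mod_cast hi.1)
      refine (h' m b hb i hi.1 (by omega)).trans ?_
      refine div_le_div₀ (by positivity) ?_ hm (by nlinarith)
      exact mul_le_mul_of_nonneg_left (pow_le_pow_right₀ hl (Nat.le_succ _)) hK'
    refine (norm_sum_le_of_le _ hterm).trans ?_
    rw [Finset.sum_const, nsmul_eq_mul, List.length_cons, Nat.card_Ioo]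
    have : ((n - 0 - 1 : ℕ) : ℝ) ≤ n := by exact_mod_cast (by omega)
    calc _ ≤ (n : ℝ) * (K' * lam m ^ (w.length + 1) / m) := by gcongr
      _ = _ := by ring

/-- The comparison at the level of the final error term. -/
def CloseStrong (C K : ℝ) (w : Index) : Prop :=
  ∀ m b, Approx C m b → ∀ n, 0 < n → 2 * n ≤ m + 2 →
    ‖nestedSum b w n - truncL w n‖ ≤ K * lam m ^ w.length / m

/-- An exponent of at least two leaves a spare `1 / n` in each term, so the errors add up to a
harmonic sum instead of a factor `n`. -/
theorem exists_closeStrong_of_two_le (C : ℝ) (hC : 0 ≤ C) {p : ℂ × ℕ} {w : Index}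
    (hw : Valid (p :: w)) (hp : 2 ≤ p.2) : ∃ K, 0 ≤ K ∧ CloseStrong C K (p :: w) := by
  obtain ⟨K, hK, h⟩ := exists_close C hC (valid_cons.1 hw).2
  obtain ⟨K', hK', h'⟩ := h.exists_term_le hC hK hw
  refine ⟨K', hK', fun m b hb n hn hnm => ?_⟩
  rw [nestedSum_cons, truncL, nestedSum_cons, ← Finset.sum_sub_distrib]
  have hl := lam_pos m
  rcases Nat.eq_zero_or_pos m with rfl | hm0
  · have : n = 1 := by omega
    subst this
    simp [show Ioo 0 1 = (∅ : Finset ℕ) from rfl]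
  have hm : (0 : ℝ) < m := by exact_mod_cast hm0
  have hterm : ∀ i ∈ Ioo 0 n, ‖letterFun b p i * nestedSum b w i -
      letterFun (fun n => (n : ℂ)) p i * nestedSum (fun n => (n : ℂ)) w i‖ ≤
      K' * lam m ^ w.length / m * (i : ℝ)⁻¹ := by
    intro i hi
    rw [Finset.mem_Ioo] at hi
    have hi0 : (0 : ℝ) < i := by exact_mod_cast hi.1
    have hi1 : (i : ℝ) ≤ (i : ℝ) ^ (p.2 - 1) :=
      le_self_pow₀ (by exact_mod_cast hi.1) (by omega)
    refine (h' m b hb i hi.1 (by omega)).trans ?_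
    rw [← div_eq_mul_inv, div_div]
    gcongr
  refine (norm_sum_le_of_le _ hterm).trans ?_
  rw [← Finset.mul_sum, List.length_cons, pow_succ]
  have h2 : ∑ i ∈ Ioo 0 n, (i : ℝ)⁻¹ ≤ lam m :=
    (sum_Ioo_inv_le n).trans (lam_mono (by omega))
  calc _ ≤ K' * lam m ^ w.length / m * lam m := by gcongr
    _ = _ := by ring

theorem abel_sum (η : ℂ) (f : ℕ → ℂ) {N : ℕ} (hN : 0 < N) :
    (η - 1) * ∑ n ∈ Ioo 0 (N + 1), η ^ n * f n =
      η ^ (N + 1) * f N - η * f 1 + ∑ n ∈ Ioo 0 N, η ^ (n + 1) * (f n - f (n + 1)) := by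
  induction N, hN using Nat.le_induction with
  | base =>
    simp [sum_Ioo_succ, show Ioo 0 1 = (∅ : Finset ℕ) from rfl]
    ring
  | succ N hN ih =>
    rw [sum_Ioo_succ _ (Nat.succ_pos N), mul_add, ih, sum_Ioo_succ _ hN]
    simp only [Nat.succ_eq_add_one]
    ring

theorem norm_abel_sum_le {η : ℂ} (hη : ‖η‖ = 1) (f : ℕ → ℂ) {N : ℕ} (hN : 0 < N) :
    ‖η - 1‖ * ‖∑ n ∈ Ioo 0 (N + 1), η ^ n * f n‖ ≤
      ‖f N‖ + ‖f 1‖ + ∑ n ∈ Ioo 0 N, ‖f n - f (n + 1)‖ := by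
  rw [← norm_mul, abel_sum η f hN]
  refine (norm_add_le _ _).trans (add_le_add ((norm_sub_le _ _).trans ?_) (norm_sum_le_of_le _ ?_))
  · simp [hη]
  · intro n _; simp [hη]

theorem norm_nestedSum_succ_sub_le {b : ℕ → ℂ} {A : ℝ} (hA : 0 ≤ A) {w : Index} (hw : Valid w)
    {n : ℕ} (hn : 0 < n) (hb : ∀ i, 0 < i → i ≤ n → ‖(b i)⁻¹‖ ≤ A / i) :
    ‖nestedSum b w (n + 1) - nestedSum b w n‖ ≤
      A ^ (w.map Prod.snd).sum * lam n ^ w.length / n := by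
  cases w with
  | nil => simp [nestedSum]
  | cons p w =>
    rw [valid_cons] at hw
    rw [nestedSum_cons_succ _ _ _ hn, add_sub_cancel_left, norm_mul]
    have h1 := norm_letterFun_le hw.1 hA hn (hb n hn le_rfl)
    have h2 := norm_nestedSum_le hA hw.2 fun i hi (hin : i < n) => hb i hi hin.le
    have hl := lam_pos n
    calc _ ≤ A ^ p.2 / n * (A ^ (w.map Prod.snd).sum * lam n ^ (w.length + 1)) := by
          refine mul_le_mul h1 (h2.trans ?_) (norm_nonneg _) (by positivity)
          gcongr
          · exact one_le_lam n
          · exact Nat.le_succ _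
      _ = _ := by rw [List.map_cons, List.sum_cons, pow_add, List.length_cons]; ring

theorem exists_norm_succ_sub_sub_le (C : ℝ) (hC : 0 ≤ C) {w : Index} (hw : Valid w) :
    ∃ K, 0 ≤ K ∧ ∀ m b, Approx C m b → ∀ n, 0 < n → 2 * n ≤ m →
      ‖(nestedSum b w (n + 1) - nestedSum b w n) - (truncL w (n + 1) - truncL w n)‖ ≤
        K * lam m ^ w.length / m := by
  cases w with
  | nil => exact ⟨0, le_rfl, fun m b _ n _ _ => by simp [nestedSum, truncL]⟩
  | cons p w =>
    obtain ⟨K, hK, h⟩ := exists_close C hC (valid_cons.1 hw).2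
    obtain ⟨K', hK', h'⟩ := h.exists_term_le hC hK hw
    refine ⟨K', hK', fun m b hb n hn hnm => ?_⟩
    rw [truncL, truncL, nestedSum_cons_succ _ _ _ hn, nestedSum_cons_succ _ _ _ hn,
      add_sub_cancel_left, add_sub_cancel_left]
    have hm : (0 : ℝ) < m := by exact_mod_cast (by omega : 0 < m)
    have hi1 : (1 : ℝ) ≤ (n : ℝ) ^ (p.2 - 1) := one_le_pow₀ (by exact_mod_cast hn)
    refine (h' m b hb n hn (by omega)).trans ?_
    refine div_le_div₀ (by have := lam_pos m; positivity) ?_ hm (by nlinarith)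
    exact mul_le_mul_of_nonneg_left (pow_le_pow_right₀ (one_le_lam m) (Nat.le_succ _)) hK'

theorem norm_inv_sub_inv_succ_le {n : ℕ} (hn : 0 < n) :
    ‖(n : ℂ)⁻¹ - ((n + 1 : ℕ) : ℂ)⁻¹‖ ≤ 1 / (n : ℝ) ^ 2 := by
  have h0 : (n : ℂ) ≠ 0 := by exact_mod_cast hn.ne'
  have h1 : ((n + 1 : ℕ) : ℂ) ≠ 0 := by exact_mod_cast (Nat.succ_ne_zero n)
  have hn' : (0 : ℝ) < n := by exact_mod_cast hn
  have e : (n : ℂ)⁻¹ - ((n + 1 : ℕ) : ℂ)⁻¹ = 1 / ((n : ℂ) * ((n + 1 : ℕ) : ℂ)) := by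
    field_simp
    push_cast
    ring
  rw [e, norm_div, norm_one, norm_mul, Complex.norm_natCast, Complex.norm_natCast]
  push_cast
  exact div_le_div_of_nonneg_left zero_le_one (by positivity) (by nlinarith)

/-- The discrete product rule. Differencing gains a factor `1 / n` over the size of the terms, which
makes the total variation in the Abel summation below only logarithmic over `m`. -/
theorem exists_norm_diff_le (C : ℝ) (hC : 0 ≤ C) {w : Index} (hw : Valid w) :
    ∃ K, 0 ≤ K ∧ ∀ m b, Approx C m b → ∀ n, 0 < n → 2 * (n + 1) ≤ m →
      ‖((b n)⁻¹ * nestedSum b w n - (n : ℂ)⁻¹ * truncL w n) -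
        ((b (n + 1))⁻¹ * nestedSum b w (n + 1) - ((n + 1 : ℕ) : ℂ)⁻¹ * truncL w (n + 1))‖ ≤
        K * lam m ^ w.length / m * (n : ℝ)⁻¹ := by
  obtain ⟨K₁, hK₁, h₁⟩ := exists_close C hC hw
  obtain ⟨K₂, hK₂, h₂⟩ := exists_norm_succ_sub_sub_le C hC hw
  set A := (1 + C) ^ (w.map Prod.snd).sum with hAdef
  have hA : 0 ≤ A := by positivity
  refine ⟨C * A + K₁ + (C * A + K₂), by positivity, fun m b hb n hn hnm => ?_⟩
  have hm : (0 : ℝ) < m := by exact_mod_cast (by omega : 0 < m)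
  have hn' : (0 : ℝ) < n := by exact_mod_cast hn
  have hl := lam_pos m
  have hln : lam n ^ w.length ≤ lam m ^ w.length :=
    pow_le_pow_left₀ (lam_pos n).le (lam_mono (by omega)) _
  have hH : ‖nestedSum b w n‖ ≤ A * lam m ^ w.length :=
    (hb.norm_nestedSum_le hC hw (n := n) (by omega)).trans (by gcongr)
  have hdH : ‖nestedSum b w (n + 1) - nestedSum b w n‖ ≤ A * lam m ^ w.length / n :=
    (norm_nestedSum_succ_sub_le (by linarith : 0 ≤ 1 + C) hw hn
      fun i hi hin => hb.inv_le hC hi (by omega)).trans (by gcongr)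
  have hHL := h₁ m b hb n hn (by omega)
  have hdHL := h₂ m b hb n hn (by omega)
  have hδ := hb.near_succ n hn hnm
  have hδ' := hb.near (n + 1) n.succ_pos hnm
  have hv := norm_inv_sub_inv_succ_le hn
  have hv' : ‖((n + 1 : ℕ) : ℂ)⁻¹‖ ≤ 1 / n := by
    rw [norm_inv, Complex.norm_natCast, one_div]
    gcongr
    exact Nat.le_succ n
  have e : ((b n)⁻¹ * nestedSum b w n - (n : ℂ)⁻¹ * truncL w n) -
        ((b (n + 1))⁻¹ * nestedSum b w (n + 1) - ((n + 1 : ℕ) : ℂ)⁻¹ * truncL w (n + 1)) =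
      (((b n)⁻¹ - (n : ℂ)⁻¹) - ((b (n + 1))⁻¹ - ((n + 1 : ℕ) : ℂ)⁻¹)) * nestedSum b w n +
      ((n : ℂ)⁻¹ - ((n + 1 : ℕ) : ℂ)⁻¹) * (nestedSum b w n - truncL w n) -
      (((b (n + 1))⁻¹ - ((n + 1 : ℕ) : ℂ)⁻¹) * (nestedSum b w (n + 1) - nestedSum b w n) +
        ((n + 1 : ℕ) : ℂ)⁻¹ * ((nestedSum b w (n + 1) - nestedSum b w n) -
          (truncL w (n + 1) - truncL w n))) := by ring
  rw [e]
  refine (norm_sub_le _ _).trans (le_trans (add_le_add (norm_add_le _ _) (norm_add_le _ _)) ?_)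
  simp only [norm_mul]
  calc _ ≤ (C / (m * n) * (A * lam m ^ w.length) +
            1 / (n : ℝ) ^ 2 * (K₁ * lam m ^ w.length * n / m)) +
          (C / m * (A * lam m ^ w.length / n) + 1 / n * (K₂ * lam m ^ w.length / m)) := by
        gcongr
    _ = _ := by field_simp

/-- With exponent one the errors are not small enough in absolute value, but the powers of `η ≠ 1`
oscillate. Abel summation replaces the sum by boundary terms and a total variation, at the price of
`1 / ‖η - 1‖`. This makes the constant depend on `η`, while the power of the logarithm does not. -/
theorem exists_closeStrong_of_ne_one (C : ℝ) (hC : 0 ≤ C) {η : ℂ} {w : Index}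
    (hw : Valid ((η, 1) :: w)) (hη : η ≠ 1) : ∃ K, 0 ≤ K ∧ CloseStrong C K ((η, 1) :: w) := by
  have hw' := (valid_cons.1 hw).2
  have hη1 : ‖η‖ = 1 := (valid_cons.1 hw).1.1
  obtain ⟨K₁, hK₁, h₁⟩ := exists_close C hC hw'
  obtain ⟨K₂, hK₂, h₂⟩ := h₁.exists_term_le (p := (1, 1)) hC hK₁ (valid_cons.2 ⟨by simp, hw'⟩)
  obtain ⟨K₃, hK₃, h₃⟩ := exists_norm_diff_le C hC hw'
  have hη0 : 0 < ‖η - 1‖ := norm_pos_iff.2 (sub_ne_zero.2 hη)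
  -- `K₂` is spent on each of the two boundary terms and `K₃` on the variation.
  refine ⟨(K₂ + K₂ + K₃) / ‖η - 1‖, by positivity, fun m b hb n hn hnm => ?_⟩
  have hl := one_le_lam m
  obtain ⟨N, rfl⟩ : ∃ N, n = N + 1 := ⟨n - 1, by omega⟩
  rcases Nat.eq_zero_or_pos N with rfl | hN
  · have : Ioo 0 (0 + 1) = (∅ : Finset ℕ) := rfl
    rw [truncL, nestedSum_cons, nestedSum_cons, this]
    simp only [Finset.sum_empty, sub_self, norm_zero]
    positivity
  have hm : (0 : ℝ) < m := by exact_mod_cast (by omega : 0 < m)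
  set f : ℕ → ℂ := fun n => (b n)⁻¹ * nestedSum b w n - (n : ℂ)⁻¹ * truncL w n with hf
  have e : nestedSum b ((η, 1) :: w) (N + 1) - truncL ((η, 1) :: w) (N + 1) =
      ∑ n ∈ Ioo 0 (N + 1), η ^ n * f n := by
    rw [truncL, nestedSum_cons, nestedSum_cons, ← Finset.sum_sub_distrib]
    refine Finset.sum_congr rfl fun n _ => ?_
    simp only [hf, letterFun, truncL, pow_one, div_eq_mul_inv]
    ring
  have hfb : ∀ n, 0 < n → 2 * n ≤ m → ‖f n‖ ≤ K₂ * lam m ^ w.length / m := by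
    intro n hn hnm
    simpa [hf, letterFun] using h₂ m b hb n hn hnm
  have hsum : ∑ n ∈ Ioo 0 N, ‖f n - f (n + 1)‖ ≤ K₃ * lam m ^ w.length / m * lam m := by
    calc _ ≤ ∑ n ∈ Ioo 0 N, K₃ * lam m ^ w.length / m * (n : ℝ)⁻¹ := by
          refine Finset.sum_le_sum fun n hn => ?_
          rw [Finset.mem_Ioo] at hn
          exact h₃ m b hb n hn.1 (by omega)
      _ ≤ _ := by
          rw [← Finset.mul_sum]
          gcongr
          exact (sum_Ioo_inv_le N).trans (lam_mono (by omega))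
  have hmain := norm_abel_sum_le hη1 f hN
  rw [e, List.length_cons]
  have hup : lam m ^ w.length ≤ lam m ^ (w.length + 1) := pow_le_pow_right₀ hl (Nat.le_succ _)
  have hb1 : K₂ * lam m ^ w.length / m ≤ K₂ * lam m ^ (w.length + 1) / m := by gcongr
  have : ‖η - 1‖ * ‖∑ n ∈ Ioo 0 (N + 1), η ^ n * f n‖ ≤
      (K₂ + K₂ + K₃) * lam m ^ (w.length + 1) / m := by
    calc _ ≤ _ := hmain
      _ ≤ K₂ * lam m ^ (w.length + 1) / m + K₂ * lam m ^ (w.length + 1) / m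
          + K₃ * lam m ^ w.length / m * lam m :=
        add_le_add (add_le_add ((hfb N hN (by omega)).trans hb1)
          ((hfb 1 one_pos (by omega)).trans hb1)) hsum
      _ = _ := by rw [pow_succ]; ring
  rw [div_mul_eq_mul_div, div_right_comm, le_div_iff₀ hη0, mul_comm]
  exact this

/-- The index does not start with the letter `(1, 1)`. -/
def Admissible (w : Index) : Prop := w.head? ≠ some (1, 1)

theorem exists_closeStrong (C : ℝ) (hC : 0 ≤ C) {w : Index} (hw : Valid w) (ha : Admissible w) :
    ∃ K, 0 ≤ K ∧ CloseStrong C K w := by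
  match w, hw, ha with
  | [], _, _ => exact ⟨0, le_rfl, fun m b _ n _ _ => by simp [nestedSum, truncL]⟩
  | (η, k) :: w, hw, ha =>
    have hk : 0 < k := (valid_cons.1 hw).1.2
    rcases Nat.lt_or_ge 1 k with h | h
    · exact exists_closeStrong_of_two_le C hC hw h
    · obtain rfl : k = 1 := by omega
      exact exists_closeStrong_of_ne_one C hC hw (by rintro rfl; exact ha rfl)

/-! ### Limits of the truncated sums of admissible words -/

/-- The increments are dominated by those of an explicit decreasing null sequence `v n = 4K (B + log
n) ^ r / n`. Telescoping yields both convergence and the rate. -/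
theorem exists_limit_of_norm_succ_sub_le (a : ℕ → ℂ) {K : ℝ} (hK : 0 ≤ K) (r : ℕ)
    (h : ∀ n, 0 < n → ‖a (n + 1) - a n‖ ≤ K * lam n ^ r / (n : ℝ) ^ 2) :
    ∃ (c : ℂ) (K' : ℝ), 0 ≤ K' ∧ ∀ n, 0 < n → ‖a n - c‖ ≤ K' * lam n ^ r / n := by
  set B : ℝ := 4 * (r + 1) with hB
  have hB1 : 1 ≤ B := by have : (0 : ℝ) ≤ r := by positivity
                         linarith
  set y : ℕ → ℝ := fun n => (B + Real.log n) ^ r with hy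
  set v : ℕ → ℝ := fun n => 4 * K * y n / n with hv
  have hlog : ∀ n : ℕ, 0 ≤ Real.log n := fun n => Real.log_natCast_nonneg n
  have hBl : ∀ n : ℕ, 0 < B + Real.log n := fun n => by have := hlog n; linarith
  have hlam : ∀ n, lam n ^ r ≤ y n := fun n =>
    pow_le_pow_left₀ (lam_pos n).le (by unfold lam; linarith) _
  have hlam' : ∀ n, y n ≤ B ^ r * lam n ^ r := fun n => by
    rw [← mul_pow]
    exact pow_le_pow_left₀ (hBl n).le (by unfold lam; nlinarith [hlog n]) _
  have hv0 : ∀ n, 0 ≤ v n := fun n => by have := hBl n; positivity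
  -- One step multiplies `B + log n` by at most `1 + t`, where `t = 1 / (n B)`. Bernoulli's
  -- inequality bounds `(1 - t) ^ r` below by `1 - 1 / (4n)`, and `(1 + t)(1 - t) ≤ 1`.
  have hystep : ∀ n, 0 < n → y (n + 1) * (1 - 1 / (4 * n)) ≤ y n := by
    intro n hn
    have hn' : (1 : ℝ) ≤ n := by exact_mod_cast hn
    set t : ℝ := 1 / (n * B) with ht
    have ht0 : 0 ≤ t := by positivity
    have ht1 : t ≤ 1 := by rw [ht, div_le_one (by positivity)]; nlinarith
    have hl : B + Real.log ((n + 1 : ℕ) : ℝ) ≤ (B + Real.log n) * (1 + t) := by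
      have h1 : Real.log ((n + 1 : ℕ) : ℝ) ≤ Real.log n + 1 / n := by
        have e : ((n + 1 : ℕ) : ℝ) = n * (1 + 1 / n) := by push_cast; field_simp
        rw [e, Real.log_mul (by positivity) (by positivity)]
        have := Real.log_le_sub_one_of_pos (show (0 : ℝ) < 1 + 1 / n by positivity)
        linarith
      have h2 : (1 : ℝ) / n = B * t := by rw [ht]; field_simp
      nlinarith [mul_nonneg (hlog n) ht0]
    have h3 : 1 - 1 / (4 * (n : ℝ)) ≤ (1 - t) ^ r := by
      have h4 := one_add_mul_le_pow (show (-2 : ℝ) ≤ -t by linarith) r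
      have h5 : (r : ℝ) * t ≤ 1 / (4 * n) := by
        rw [ht, hB, mul_one_div, div_le_div_iff₀ (by positivity) (by positivity)]
        nlinarith
      rw [← sub_eq_add_neg] at h4
      linarith
    have h6 : 0 ≤ y (n + 1) := pow_nonneg (hBl _).le _
    calc y (n + 1) * (1 - 1 / (4 * n)) ≤ y (n + 1) * (1 - t) ^ r := by gcongr
      _ ≤ ((B + Real.log n) * (1 + t)) ^ r * (1 - t) ^ r := by
          have h7 : y (n + 1) ≤ ((B + Real.log n) * (1 + t)) ^ r :=
            pow_le_pow_left₀ (hBl _).le hl _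
          exact mul_le_mul_of_nonneg_right h7 (pow_nonneg (by linarith) _)
      _ = (B + Real.log n) ^ r * (1 - t ^ 2) ^ r := by
          rw [← mul_pow, ← mul_pow]; congr 1; ring
      _ ≤ (B + Real.log n) ^ r * 1 := by
          have := hBl n
          gcongr
          exact pow_le_one₀ (by nlinarith) (by nlinarith)
      _ = y n := by rw [mul_one]
  have hvstep : ∀ n, 0 < n → ‖a (n + 1) - a n‖ ≤ v n - v (n + 1) := by
    intro n hn
    have hn' : (1 : ℝ) ≤ n := by exact_mod_cast hn
    have hs := hystep n hn
    have hy0 : 0 ≤ y n := pow_nonneg (hBl _).le _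
    have h1 : y (n + 1) ≤ y n * (4 * n / (4 * n - 1)) := by
      have e : (1 : ℝ) - 1 / (4 * n) = (4 * n - 1) / (4 * n) := by field_simp
      rw [e, mul_div_assoc', div_le_iff₀ (by positivity)] at hs
      rw [mul_div_assoc', le_div_iff₀ (by linarith)]
      exact hs
    have h2 : v (n + 1) ≤ 4 * K * (y n * (4 * n / (4 * n - 1))) / (n + 1) := by
      simp only [hv]
      push_cast
      gcongr
    have h3 : K * lam n ^ r / (n : ℝ) ^ 2 ≤ K * y n / (n : ℝ) ^ 2 := by
      have := hlam n
      gcongr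
    refine ((h n hn).trans h3).trans ?_
    have h4 : K * y n / (n : ℝ) ^ 2 ≤
        4 * K * y n / n - 4 * K * (y n * (4 * n / (4 * n - 1))) / (n + 1) := by
      have h5 : 0 < 4 * (n : ℝ) - 1 := by linarith
      have h6 : (1 : ℝ) / (n : ℝ) ^ 2 ≤ 4 / n - 4 * (4 * n / (4 * n - 1)) / (n + 1) := by
        have e : (4 : ℝ) / n - 4 * (4 * n / (4 * n - 1)) / (n + 1) =
            4 * (3 * n - 1) / (n * (4 * n - 1) * (n + 1)) := by field_simp; ring
        rw [e, div_le_div_iff₀ (by positivity) (by positivity)]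
        have : 0 ≤ (n : ℝ) * (8 * n ^ 2 - 7 * n + 1) :=
          mul_nonneg (by linarith) (by nlinarith)
        nlinarith
      have h7 := mul_le_mul_of_nonneg_left h6 (mul_nonneg hK hy0)
      calc K * y n / (n : ℝ) ^ 2 = K * y n * (1 / (n : ℝ) ^ 2) := by ring
        _ ≤ _ := h7
        _ = _ := by ring
    have h8 : v n = 4 * K * y n / n := rfl
    linarith
  have hvlim : Tendsto v atTop (𝓝 0) := by
    -- Substituting `x = e ^ B n` absorbs the shift: `log x = B + log n` and `e ^ (-B) x = n`.
    have h1 := Real.tendsto_pow_log_div_mul_add_atTop (Real.exp (-B)) 0 r (Real.exp_pos _).ne'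
    have h2 : Tendsto (fun n : ℕ => Real.exp B * (n : ℝ)) atTop atTop :=
      tendsto_natCast_atTop_atTop.const_mul_atTop (Real.exp_pos _)
    have h3 := (h1.comp h2).const_mul (4 * K)
    rw [mul_zero] at h3
    refine h3.congr' ?_
    filter_upwards [eventually_gt_atTop 0] with n hn
    have hn' : (0 : ℝ) < n := by exact_mod_cast hn
    simp only [Function.comp, hv, hy]
    rw [Real.log_mul (Real.exp_pos _).ne' hn'.ne', Real.log_exp, add_zero, ← mul_assoc,
      ← Real.exp_add, neg_add_cancel, Real.exp_zero, one_mul, mul_div_assoc]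
  have hpn : ∀ n, 0 < n → ∀ p, n ≤ p → ‖a p - a n‖ ≤ v n - v p := by
    intro n hn p hp
    induction p, hp using Nat.le_induction with
    | base => simp
    | succ p hp ih =>
      have := hvstep p (by omega)
      calc ‖a (p + 1) - a n‖ = ‖(a (p + 1) - a p) + (a p - a n)‖ := by rw [sub_add_sub_cancel]
        _ ≤ _ := norm_add_le _ _
        _ ≤ _ := by linarith
  have hcau : CauchySeq fun n => a (n + 1) := by
    refine cauchySeq_of_le_tendsto_0' (fun n => v (n + 1)) ?_ ((tendsto_add_atTop_iff_nat 1).2 hvlim)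
    intro n m hnm
    rw [dist_comm, dist_eq_norm]
    have := hpn (n + 1) n.succ_pos (m + 1) (by omega)
    have := hv0 (m + 1)
    linarith
  obtain ⟨c, hc⟩ := cauchySeq_tendsto_of_complete hcau
  rw [tendsto_add_atTop_iff_nat 1] at hc
  refine ⟨c, 4 * K * B ^ r, by positivity, fun n hn => ?_⟩
  have h1 : ‖c - a n‖ ≤ v n := by
    refine le_of_tendsto (hc.sub_const (a n)).norm ?_
    filter_upwards [eventually_ge_atTop n] with p hp
    have := hpn n hn p hp
    have := hv0 p
    linarith
  rw [norm_sub_rev]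
  refine h1.trans ?_
  have := hlam' n
  calc v n = 4 * K * y n / n := rfl
    _ ≤ 4 * K * (B ^ r * lam n ^ r) / n := by gcongr
    _ = _ := by ring

theorem exists_truncL_limit {w : Index} (hw : Valid w) (ha : Admissible w) :
    ∃ (c : ℂ) (K : ℝ), 0 ≤ K ∧ ∀ n, 0 < n → ‖truncL w n - c‖ ≤ K * lam n ^ w.length / n := by
  match w, hw, ha with
  | [], _, _ => exact ⟨1, 0, le_rfl, fun n _ => by simp [nestedSum, truncL]⟩
  | (η, k) :: w, hw, ha =>
    obtain ⟨⟨hη : ‖η‖ = 1, hk : 0 < k⟩, hw'⟩ := valid_cons.1 hw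
    rcases Nat.lt_or_ge 1 k with h | h
    · obtain ⟨c, K, hK, hc⟩ := exists_limit_of_norm_succ_sub_le (truncL ((η, k) :: w))
        zero_le_one (w.length + 1) fun n hn => by
          rw [truncL, truncL, nestedSum_cons_succ _ _ _ hn, add_sub_cancel_left, norm_mul,
            norm_letterFun _ hη]
          have hn' : (1 : ℝ) ≤ n := by exact_mod_cast hn
          have h1 : ‖((n : ℂ))⁻¹‖ ^ k ≤ 1 / (n : ℝ) ^ 2 := by
            rw [norm_inv, Complex.norm_natCast, inv_pow, ← one_div]
            exact div_le_div_of_nonneg_left zero_le_one (by positivity)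
              (pow_le_pow_right₀ hn' h)
          have h2 : ‖truncL w n‖ ≤ lam n ^ (w.length + 1) :=
            (norm_truncL_le hw' n).trans (pow_le_pow_right₀ (one_le_lam n) (Nat.le_succ _))
          calc _ ≤ 1 / (n : ℝ) ^ 2 * lam n ^ (w.length + 1) :=
                mul_le_mul h1 h2 (norm_nonneg _) (by positivity)
            _ = _ := by ring
      exact ⟨c, K, hK, hc⟩
    · obtain rfl : k = 1 := by omega
      have hη1 : η - 1 ≠ 0 := sub_ne_zero.2 (by rintro rfl; exact ha rfl)
      set F : ℕ → ℂ := fun n => (n : ℂ)⁻¹ * truncL w n with hF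
      -- Summation by parts: subtracting `η ^ n F n` leaves the increment `η ^ (n + 1) (F n - F (n +
      -- 1))`, which is of order `lam n ^ r / n ^ 2` with `r` the length of the tail.
      obtain ⟨c, K, hK, hc⟩ := exists_limit_of_norm_succ_sub_le
        (fun n => (η - 1) * truncL ((η, 1) :: w) n - η ^ n * F n)
        zero_le_two w.length fun n hn => by
          have hn' : (0 : ℝ) < n := by exact_mod_cast hn
          have e : ((η - 1) * truncL ((η, 1) :: w) (n + 1) - η ^ (n + 1) * F (n + 1)) -
              ((η - 1) * truncL ((η, 1) :: w) n - η ^ n * F n) =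
              η ^ (n + 1) * (((n : ℂ)⁻¹ - ((n + 1 : ℕ) : ℂ)⁻¹) * truncL w n -
                ((n + 1 : ℕ) : ℂ)⁻¹ * (truncL w (n + 1) - truncL w n)) := by
            have h1 : truncL ((η, 1) :: w) (n + 1) =
                truncL ((η, 1) :: w) n + η ^ n * F n := by
              rw [truncL, nestedSum_cons_succ _ _ _ hn]
              simp only [letterFun, hF, truncL, pow_one, div_eq_mul_inv]
              ring
            rw [h1]
            simp only [hF]
            ring
          rw [e, norm_mul, norm_pow, hη, one_pow, one_mul]
          refine (norm_sub_le _ _).trans ?_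
          rw [norm_mul, norm_mul]
          have h2 := norm_inv_sub_inv_succ_le hn
          have h3 := norm_truncL_le hw' n
          have h4 : ‖truncL w (n + 1) - truncL w n‖ ≤ lam n ^ w.length / n := by
            have := norm_nestedSum_succ_sub_le (b := fun n => (n : ℂ)) (A := 1) zero_le_one hw' hn
              fun i _ _ => by simp
            simpa [truncL] using this
          have h5 : ‖((n + 1 : ℕ) : ℂ)⁻¹‖ ≤ 1 / n := by
            rw [norm_inv, Complex.norm_natCast, one_div]
            gcongr
            exact Nat.le_succ n
          calc _ ≤ 1 / (n : ℝ) ^ 2 * lam n ^ w.length + 1 / n * (lam n ^ w.length / n) := by gcongr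
            _ = _ := by field_simp; ring
      have hη0 : 0 < ‖η - 1‖ := norm_pos_iff.2 hη1
      refine ⟨c / (η - 1), (K + 1) / ‖η - 1‖, by positivity, fun n hn => ?_⟩
      have hn' : (0 : ℝ) < n := by exact_mod_cast hn
      have e : truncL ((η, 1) :: w) n - c / (η - 1) =
          (((η - 1) * truncL ((η, 1) :: w) n - η ^ n * F n - c) + η ^ n * F n) / (η - 1) := by
        field_simp
        ring
      have hl := one_le_lam n
      rw [e, norm_div, div_mul_eq_mul_div, div_right_comm]
      gcongr
      refine (norm_add_le _ _).trans ?_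
      have h1 : ‖η ^ n * F n‖ ≤ lam n ^ w.length / n := by
        have := norm_truncL_le hw' n
        simp only [hF, norm_mul, norm_pow, hη, one_pow, one_mul, norm_inv, Complex.norm_natCast]
        rw [inv_mul_eq_div]
        gcongr
      have h2 : (K + 1) * lam n ^ w.length ≤ (K + 1) * lam n ^ (w.length + 1) := by
        gcongr
        exact Nat.le_succ _
      calc _ ≤ K * lam n ^ w.length / n + lam n ^ w.length / n := add_le_add (hc n hn) h1
        _ = (K + 1) * lam n ^ w.length / n := by ring
        _ ≤ _ := by
          rw [List.length_cons]
          gcongr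

/-! ### Estimates for `cot x - 1 / x` -/

/-- The regular part of the cotangent at the origin. -/
def cotReg (x : ℝ) : ℝ := Real.cos x / Real.sin x - 1 / x

/-- A primitive of `cotReg`. -/
def cotRegInt (x : ℝ) : ℝ := Real.log (Real.sin x) - Real.log x

section cotReg

variable {x y : ℝ}

theorem half_le_sin (hx0 : 0 < x) (hx : x ≤ Real.pi / 2) : x / 2 ≤ Real.sin x := by
  refine le_trans ?_ (Real.mul_le_sin hx0.le hx)
  have h : (1 : ℝ) / 2 ≤ 2 / Real.pi := by
    rw [div_le_div_iff₀ two_pos Real.pi_pos]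
    have := Real.pi_le_four
    linarith
  calc x / 2 = 1 / 2 * x := by ring
    _ ≤ _ := by gcongr

theorem sub_sin_le (hx0 : 0 < x) : x - Real.sin x ≤ x ^ 3 := by
  have := Real.sin_gt_sub_cube hx0
  have : 0 ≤ x ^ 3 := by positivity
  linarith

theorem abs_cotReg_le (hx0 : 0 < x) (hx : x ≤ Real.pi / 2) : |cotReg x| ≤ 6 := by
  have hs := half_le_sin hx0 hx
  have hs0 : 0 < Real.sin x := by linarith
  have h1 := sub_sin_le hx0
  have h2 := Real.one_sub_sq_div_two_le_cos (x := x)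
  have h3 := Real.sin_le hx0.le
  have h4 := Real.cos_le_one x
  have hx2 : x ≤ 2 := by have := Real.pi_le_four; linarith
  have e : cotReg x = (x * Real.cos x - Real.sin x) / (x * Real.sin x) := by
    unfold cotReg; field_simp
  have h5 : x * (x / 2) ≤ x * Real.sin x := by gcongr
  rw [e, abs_div, abs_of_pos (by positivity : 0 < x * Real.sin x), div_le_iff₀ (by positivity),
    abs_le]
  have h6 : x ^ 3 ≤ 2 * x ^ 2 := by nlinarith [sq_nonneg x]
  constructor
  · nlinarith [mul_le_mul_of_nonneg_left h2 hx0.le]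
  · nlinarith [mul_le_mul_of_nonneg_left h4 hx0.le, sq_nonneg x]

theorem hasDerivAt_cotReg (hx0 : 0 < x) (hx : x ≤ Real.pi / 2) :
    HasDerivAt cotReg (1 / x ^ 2 - 1 / Real.sin x ^ 2) x := by
  have hs0 : 0 < Real.sin x := by linarith [half_le_sin hx0 hx]
  have h := ((Real.hasDerivAt_cos x).div (Real.hasDerivAt_sin x) hs0.ne').sub
    (hasDerivAt_inv hx0.ne')
  have e : cotReg = (fun y => Real.cos y / Real.sin y) - fun y => y⁻¹ := by
    ext y; simp [cotReg]
  rw [e]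
  refine h.congr_deriv ?_
  have := Real.sin_sq_add_cos_sq x
  field_simp
  linear_combination (-x ^ 2) * this

theorem abs_deriv_cotReg_le (hx0 : 0 < x) (hx : x ≤ Real.pi / 2) :
    |1 / x ^ 2 - 1 / Real.sin x ^ 2| ≤ 8 := by
  have hs := half_le_sin hx0 hx
  have hs0 : 0 < Real.sin x := by linarith
  have h1 := sub_sin_le hx0
  have h3 := Real.sin_le hx0.le
  have e : 1 / x ^ 2 - 1 / Real.sin x ^ 2 =
      -(((x - Real.sin x) * (x + Real.sin x)) / (x ^ 2 * Real.sin x ^ 2)) := by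
    field_simp; ring
  rw [e, abs_neg, abs_of_nonneg
    (div_nonneg (mul_nonneg (by linarith) (by linarith)) (by positivity)),
    div_le_iff₀ (by positivity)]
  have h4 : (x - Real.sin x) * (x + Real.sin x) ≤ x ^ 3 * (2 * x) :=
    mul_le_mul h1 (by linarith) (by linarith) (by positivity)
  have h5 : (x / 2) ^ 2 ≤ Real.sin x ^ 2 := by gcongr
  have h6 : x ^ 2 * (x / 2) ^ 2 ≤ x ^ 2 * Real.sin x ^ 2 := by gcongr
  nlinarith

theorem abs_cotReg_sub_le (hx0 : 0 < x) (hx : x ≤ Real.pi / 2) (hy0 : 0 < y)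
    (hy : y ≤ Real.pi / 2) : |cotReg y - cotReg x| ≤ 8 * |y - x| := by
  have h := (convex_Ioc (0 : ℝ) (Real.pi / 2)).norm_image_sub_le_of_norm_hasDerivWithin_le
    (f := cotReg) (f' := fun x => 1 / x ^ 2 - 1 / Real.sin x ^ 2) (C := 8)
    (fun z hz => (hasDerivAt_cotReg hz.1 hz.2).hasDerivWithinAt)
    (fun z hz => abs_deriv_cotReg_le hz.1 hz.2) ⟨hx0, hx⟩ ⟨hy0, hy⟩
  exact h

theorem hasDerivAt_cotRegInt (hx0 : 0 < x) (hx : x ≤ Real.pi / 2) :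
    HasDerivAt cotRegInt (cotReg x) x := by
  have hs0 : 0 < Real.sin x := by linarith [half_le_sin hx0 hx]
  have h := ((Real.hasDerivAt_sin x).log hs0.ne').sub (Real.hasDerivAt_log hx0.ne')
  rw [← one_div] at h
  exact h

theorem abs_cotRegInt_sub_le (hx0 : 0 < x) (hx : x ≤ Real.pi / 2) (hy0 : 0 < y)
    (hy : y ≤ Real.pi / 2) : |cotRegInt y - cotRegInt x| ≤ 6 * |y - x| :=
  (convex_Ioc (0 : ℝ) (Real.pi / 2)).norm_image_sub_le_of_norm_hasDerivWithin_le
    (fun _ hz => (hasDerivAt_cotRegInt hz.1 hz.2).hasDerivWithinAt)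
    (fun _ hz => abs_cotReg_le hz.1 hz.2) ⟨hx0, hx⟩ ⟨hy0, hy⟩

/-- The error of one cell of a right-endpoint Riemann sum. It is quadratic in the width because
`cotReg` is Lipschitz. -/
theorem abs_cotRegInt_sub_mul_le (hx0 : 0 < x) (hxy : x ≤ y) (hy : y ≤ Real.pi / 2) :
    |(y - x) * cotReg y - (cotRegInt y - cotRegInt x)| ≤ 8 * (y - x) ^ 2 := by
  have h := (convex_Icc x y).norm_image_sub_le_of_norm_hasDerivWithin_le
    (f := fun z => z * cotReg y - cotRegInt z) (f' := fun z => 1 * cotReg y - cotReg z)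
    (C := 8 * (y - x))
    (fun z hz => (((hasDerivAt_id z).mul_const (cotReg y)).sub
      (hasDerivAt_cotRegInt (hx0.trans_le hz.1) (hz.2.trans hy))).hasDerivWithinAt)
    (fun z hz => ?_) ⟨le_rfl, hxy⟩ ⟨hxy, le_rfl⟩
  · rw [Real.norm_eq_abs, Real.norm_eq_abs, abs_of_nonneg (sub_nonneg.2 hxy)] at h
    calc _ = |y * cotReg y - cotRegInt y - (x * cotReg y - cotRegInt x)| := by
          congr 1; ring
      _ ≤ _ := h
      _ = _ := by ring
  · have h2 := abs_cotReg_sub_le (hx0.trans_le hz.1) (hz.2.trans hy) (hx0.trans_le hxy) hy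
    rw [one_mul, Real.norm_eq_abs]
    refine h2.trans ?_
    rw [abs_of_nonneg (sub_nonneg.2 hz.2)]
    linarith [hz.1]

theorem cotRegInt_pi_div_two : cotRegInt (Real.pi / 2) = Real.log (2 / Real.pi) := by
  rw [cotRegInt, Real.sin_pi_div_two, Real.log_one, zero_sub, ← Real.log_inv, inv_div]

theorem abs_cotRegInt_le (hx0 : 0 < x) (hx : x ≤ Real.pi / 2) : |cotRegInt x| ≤ 4 * x := by
  have hs := half_le_sin hx0 hx
  have hs0 : 0 < Real.sin x := by linarith
  have h1 := sub_sin_le hx0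
  have h3 := Real.sin_le hx0.le
  have hx2 : x ≤ 2 := by have := Real.pi_le_four; linarith
  rw [cotRegInt, ← Real.log_div hs0.ne' hx0.ne', abs_le]
  constructor
  · refine le_trans ?_ (Real.one_sub_inv_le_log_of_pos (by positivity))
    rw [inv_div]
    have e : 1 - x / Real.sin x = -((x - Real.sin x) / Real.sin x) := by field_simp; ring
    rw [e, neg_le_neg_iff, div_le_iff₀ hs0]
    have h4 : 4 * x * (x / 2) ≤ 4 * x * Real.sin x := by gcongr
    nlinarith [sq_nonneg x]
  · have : Real.log (Real.sin x / x) ≤ 0 :=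
      Real.log_nonpos (by positivity) (by rw [div_le_one hx0]; exact h3)
    linarith

end cotReg

/-! ### The q-integers at `e ^ (2πi / m)` -/

/-- The primitive `m`-th root of unity `e ^ (2πi / m)`. -/
def rootQ (m : ℕ) : ℂ := Complex.exp (2 * (Real.pi : ℂ) * Complex.I / (m : ℂ))

/-- The factor `e ^ (ih) sin h / h`. -/
def kap (h : ℝ) : ℂ := Complex.exp (Complex.I * h) * ((Real.sin h / h : ℝ) : ℂ)

theorem norm_kap_le {h : ℝ} (h0 : 0 < h) (hh : h ≤ Real.pi / 2) : ‖kap h‖ ≤ 1 := by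
  rw [kap, norm_mul, mul_comm Complex.I, Complex.norm_exp_ofReal_mul_I, one_mul,
    Complex.norm_real, Real.norm_eq_abs, abs_of_nonneg, div_le_one h0]
  · exact Real.sin_le h0.le
  · have := half_le_sin h0 hh
    exact div_nonneg (by linarith) h0.le

theorem norm_kap_sub_one_le {h : ℝ} (h0 : 0 < h) (hh : h ≤ Real.pi / 2) :
    ‖kap h - 1‖ ≤ 3 * h := by
  have hs := half_le_sin h0 hh
  have h1 := sub_sin_le h0
  have h3 := Real.sin_le h0.le
  have hx2 : h ≤ 2 := by have := Real.pi_le_four; linarith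
  have hs1 : |Real.sin h / h - 1| ≤ 2 * h := by
    have e : Real.sin h / h - 1 = -((h - Real.sin h) / h) := by field_simp; ring
    rw [e, abs_neg, abs_of_nonneg (div_nonneg (by linarith) h0.le), div_le_iff₀ h0]
    nlinarith [sq_nonneg h]
  have e : kap h - 1 = Complex.exp (Complex.I * h) * ((Real.sin h / h - 1 : ℝ) : ℂ) +
      (Complex.exp (Complex.I * h) - 1) := by
    rw [kap]; push_cast; ring
  rw [e]
  refine (norm_add_le _ _).trans ?_
  rw [norm_mul, Complex.norm_real, Real.norm_eq_abs, mul_comm Complex.I,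
    Complex.norm_exp_ofReal_mul_I, one_mul, mul_comm (h : ℂ)]
  have h4 : ‖Complex.exp (Complex.I * h) - 1‖ ≤ h := by
    have := Real.norm_exp_I_mul_ofReal_sub_one_le (x := h)
    rwa [Real.norm_eq_abs, abs_of_pos h0] at this
  linarith

theorem exp_two_I_sub_one (z : ℂ) :
    Complex.exp (2 * Complex.I * z) - 1 =
      Complex.exp (Complex.I * z) * (2 * Complex.I * Complex.sin z) := by
  have h1 : Complex.exp (2 * Complex.I * z) = Complex.exp (Complex.I * z) ^ 2 := by
    rw [← Complex.exp_nat_mul]; congr 1; push_cast; ring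
  have h2 : Complex.exp (-z * Complex.I) * Complex.exp (Complex.I * z) = 1 := by
    rw [← Complex.exp_add]; simp; ring_nf; simp
  rw [Complex.sin, h1, mul_comm z]
  linear_combination h2 + (1 - Complex.exp (-z * Complex.I) * Complex.exp (Complex.I * z)
    + Complex.exp (Complex.I * z) ^ 2 - 1) * Complex.I_sq

/-- With `h = π / m`, `[n]_q = e ^ (i(n - 1)h) sin (nh) / sin h`. Inverting gives `e ^ (ih) sin h
(cot (nh) - i)`, and the pole of the cotangent is split off as `1 / (nh)`. -/
theorem inv_qInt_rootQ {m n : ℕ} (hn : 0 < n) (hnm : 2 * n ≤ m) :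
    (qInt (rootQ m) n)⁻¹ = kap (Real.pi / m) * ((n : ℂ)⁻¹ +
      ((Real.pi / m : ℝ) : ℂ) * ((cotReg (Real.pi / m * n) : ℂ) - Complex.I)) := by
  have hm : (2 : ℝ) ≤ m := by exact_mod_cast (by omega : 2 ≤ m)
  have hn1 : (1 : ℝ) ≤ n := by exact_mod_cast hn
  have hnm' : (2 : ℝ) * n ≤ m := by exact_mod_cast hnm
  have hpi := Real.pi_pos
  set h : ℝ := Real.pi / m with hh
  have h0 : 0 < h := by positivity
  have hm0 : (m : ℂ) ≠ 0 := by exact_mod_cast (by omega : m ≠ 0)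
  have hx : h * n ≤ Real.pi / 2 := by
    rw [hh, div_mul_eq_mul_div, div_le_div_iff₀ (by linarith) two_pos]
    nlinarith
  have hs1 : 0 < Real.sin h := by
    have := half_le_sin h0 (by nlinarith)
    linarith
  have hs2 : 0 < Real.sin (h * n) := by
    have := half_le_sin (by positivity) hx
    have : 0 < h * n := by positivity
    linarith
  have hq : rootQ m = Complex.exp (2 * Complex.I * (h : ℂ)) := by
    rw [rootQ, hh]; congr 1; push_cast; ring
  have hqn : rootQ m ^ n = Complex.exp (2 * Complex.I * ((h * n : ℝ) : ℂ)) := by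
    rw [hq, ← Complex.exp_nat_mul]; congr 1; push_cast; ring
  have hs1' : ((Real.sin h : ℝ) : ℂ) ≠ 0 := by exact_mod_cast hs1.ne'
  have hs2' : ((Real.sin (h * n) : ℝ) : ℂ) ≠ 0 := by exact_mod_cast hs2.ne'
  have hq1 : rootQ m ≠ 1 := by
    rw [← sub_ne_zero, hq, exp_two_I_sub_one, ← Complex.ofReal_sin]
    exact mul_ne_zero (Complex.exp_ne_zero _)
      (mul_ne_zero (mul_ne_zero two_ne_zero Complex.I_ne_zero) hs1')
  have hE : Complex.exp (Complex.I * ((h * n : ℝ) : ℂ)) =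
      ((Real.cos (h * n) : ℝ) : ℂ) + ((Real.sin (h * n) : ℝ) : ℂ) * Complex.I := by
    rw [mul_comm, Complex.exp_mul_I]; push_cast; rfl
  have hsc : ((Real.sin (h * n) : ℝ) : ℂ) ^ 2 + ((Real.cos (h * n) : ℝ) : ℂ) ^ 2 = 1 := by
    exact_mod_cast Real.sin_sq_add_cos_sq (h * n)
  rw [qInt_eq hq1, hqn, hq, exp_two_I_sub_one, exp_two_I_sub_one, ← Complex.ofReal_sin,
    ← Complex.ofReal_sin, inv_div, kap, cotReg]
  have hE0 := Complex.exp_ne_zero (Complex.I * ((h * n : ℝ) : ℂ))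
  have hn0 : (n : ℂ) ≠ 0 := by exact_mod_cast hn.ne'
  have hh0 : (h : ℂ) ≠ 0 := by exact_mod_cast h0.ne'
  rw [div_eq_iff (mul_ne_zero hE0 (mul_ne_zero (mul_ne_zero two_ne_zero Complex.I_ne_zero) hs2')),
    hE]
  set s := Real.sin (h * n)
  set c := Real.cos (h * n)
  push_cast
  field_simp
  linear_combination ((h : ℂ) * Complex.sin h * n) * (-hsc + (s : ℂ) ^ 2 * Complex.I_sq)

theorem pi_div_natCast_le {m : ℕ} (hm : 2 ≤ m) : 0 < Real.pi / m ∧ Real.pi / m ≤ Real.pi / 2 :=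
  ⟨by have : (0 : ℝ) < m := by exact_mod_cast (by omega : 0 < m)
      have := Real.pi_pos
      positivity,
    div_le_div_of_nonneg_left Real.pi_pos.le two_pos (by exact_mod_cast hm)⟩

theorem pi_div_mul_mem {m n : ℕ} (hn : 0 < n) (hnm : 2 * n ≤ m) :
    0 < Real.pi / m * n ∧ Real.pi / m * n ≤ Real.pi / 2 := by
  have hn' : (0 : ℝ) < n := by exact_mod_cast hn
  have hnm' : (2 : ℝ) * n ≤ m := by exact_mod_cast hnm
  have := Real.pi_pos
  refine ⟨mul_pos (pi_div_natCast_le (by omega)).1 hn', ?_⟩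
  rw [div_mul_eq_mul_div, div_le_div_iff₀ (by linarith) two_pos]
  nlinarith

/-- The constant comes from the second condition, where `35 h / n ≤ 140 / (m n)` because `π ≤ 4`;
the first needs only `40`. -/
theorem approx_qInt_rootQ (m : ℕ) : Approx 140 m (qInt (rootQ m)) where
  near n hn hnm := by
    obtain ⟨h0, hh⟩ := pi_div_natCast_le (show 2 ≤ m by omega)
    obtain ⟨hx0, hx⟩ := pi_div_mul_mem hn hnm
    rw [inv_qInt_rootQ hn hnm]
    have hm : (0 : ℝ) < m := by exact_mod_cast (by omega : 0 < m)
    have hpi : Real.pi / m ≤ 4 / m := by have := Real.pi_le_four; gcongr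
    set h := Real.pi / m
    have e : kap h * ((n : ℂ)⁻¹ + (h : ℂ) * ((cotReg (h * n) : ℂ) - Complex.I)) - (n : ℂ)⁻¹ =
        (kap h - 1) * (n : ℂ)⁻¹ + kap h * ((h : ℂ) * ((cotReg (h * n) : ℂ) - Complex.I)) := by
      ring
    have h1 : ‖(n : ℂ)⁻¹‖ ≤ 1 := by
      rw [norm_inv, Complex.norm_natCast]
      exact inv_le_one_of_one_le₀ (by exact_mod_cast hn)
    have h2 : ‖(cotReg (h * n) : ℂ) - Complex.I‖ ≤ 6 + 1 := by
      refine (norm_sub_le _ _).trans (add_le_add ?_ (by simp))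
      rw [Complex.norm_real]
      exact abs_cotReg_le hx0 hx
    rw [e]
    refine (norm_add_le _ _).trans ?_
    simp only [norm_mul]
    rw [Complex.norm_real, Real.norm_eq_abs, abs_of_pos h0]
    have h3 := norm_kap_sub_one_le h0 hh
    have h4 := norm_kap_le h0 hh
    calc _ ≤ 3 * h * 1 + 1 * (h * (6 + 1)) := by gcongr
      _ = 10 * h := by ring
      _ ≤ 10 * (4 / m) := by gcongr
      _ = 40 / m := by ring
      _ ≤ 140 / m := by gcongr; norm_num
  near_succ n hn hnm := by
    obtain ⟨h0, hh⟩ := pi_div_natCast_le (show 2 ≤ m by omega)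
    obtain ⟨hx0, hx⟩ := pi_div_mul_mem hn (show 2 * n ≤ m by omega)
    obtain ⟨hy0, hy⟩ := pi_div_mul_mem n.succ_pos hnm
    rw [inv_qInt_rootQ hn (by omega), inv_qInt_rootQ n.succ_pos hnm]
    have hm : (0 : ℝ) < m := by exact_mod_cast (by omega : 0 < m)
    have hn' : (1 : ℝ) ≤ n := by exact_mod_cast hn
    have hpi : Real.pi / m ≤ 4 / m := by have := Real.pi_le_four; gcongr
    set h := Real.pi / m
    -- In the difference of neighbours the constant `-i` cancels, and the Lipschitz bound on
    -- `cotReg` supplies a second factor `h`, which is at most `4 / n`.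
    have e : kap h * ((n : ℂ)⁻¹ + (h : ℂ) * ((cotReg (h * n) : ℂ) - Complex.I)) - (n : ℂ)⁻¹ -
        (kap h * (((n + 1 : ℕ) : ℂ)⁻¹ +
          (h : ℂ) * ((cotReg (h * (n + 1 : ℕ)) : ℂ) - Complex.I)) - ((n + 1 : ℕ) : ℂ)⁻¹) =
        (kap h - 1) * ((n : ℂ)⁻¹ - ((n + 1 : ℕ) : ℂ)⁻¹) +
          kap h * ((h : ℂ) * ((cotReg (h * n) - cotReg (h * (n + 1 : ℕ)) : ℝ) : ℂ)) := by
      rw [Complex.ofReal_sub]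
      ring
    have h1 := norm_inv_sub_inv_succ_le hn
    have h2 : |cotReg (h * n) - cotReg (h * (n + 1 : ℕ))| ≤ 8 * h := by
      refine (abs_cotReg_sub_le hy0 hy hx0 hx).trans_eq ?_
      have : h * n - h * (n + 1 : ℕ) = -h := by push_cast; ring
      rw [this, abs_neg, abs_of_pos h0]
    rw [e]
    refine (norm_add_le _ _).trans ?_
    simp only [norm_mul]
    rw [Complex.norm_real, Complex.norm_real, Real.norm_eq_abs, Real.norm_eq_abs, abs_of_pos h0]
    have h3 := norm_kap_sub_one_le h0 hh
    have h4 := norm_kap_le h0 hh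
    have h5 : 1 / (n : ℝ) ^ 2 ≤ 1 / n := by
      gcongr; exact le_self_pow₀ hn' two_ne_zero
    have h6 : (1 : ℝ) / m ≤ 1 / n := by
      have : (n : ℝ) ≤ m := by exact_mod_cast (by omega : n ≤ m)
      gcongr
    have h7 : h ≤ 4 * (1 / n) := by
      refine hpi.trans ?_
      rw [div_eq_mul_one_div]
      gcongr
    calc _ ≤ 3 * h * (1 / n) + 1 * (h * (8 * (4 * (1 / n)))) := by
          have h8 : ‖(n : ℂ)⁻¹ - ((n + 1 : ℕ) : ℂ)⁻¹‖ ≤ 1 / n := h1.trans h5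
          have h9 : |cotReg (h * n) - cotReg (h * (n + 1 : ℕ))| ≤ 8 * (4 * (1 / n)) :=
            h2.trans (by gcongr)
          gcongr
      _ = 35 * h * (1 / n) := by ring
      _ ≤ 35 * (4 / m) * (1 / n) := by gcongr
      _ = _ := by field_simp; norm_num

/-! ### Asymptotics of the single letter `(1, 1)` -/

theorem abs_sum_Ioo_inv_sub_le {M : ℕ} (hM : 0 < M) :
    |∑ i ∈ Ioo 0 M, (i : ℝ)⁻¹ - (Real.log M + Real.eulerMascheroniConstant)| ≤ 1 / M := by
  have e : ∑ i ∈ Ioo 0 M, (i : ℝ)⁻¹ = ((harmonic (M - 1) : ℚ) : ℝ) := by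
    rw [harmonic_eq_sum_Icc]
    push_cast
    refine Finset.sum_congr ?_ fun _ _ => rfl
    ext i; simp only [Finset.mem_Ioo, Finset.mem_Icc]; omega
  have h1 := Real.eulerMascheroniSeq_lt_eulerMascheroniConstant (M - 1)
  have h2 := Real.eulerMascheroniConstant_lt_eulerMascheroniSeq' M
  rw [Real.eulerMascheroniSeq, Nat.cast_sub (by omega : 1 ≤ M), Nat.cast_one,
    sub_add_cancel] at h1
  rw [Real.eulerMascheroniSeq', if_neg hM.ne'] at h2
  have h3 : harmonic M = harmonic (M - 1) + (M : ℚ)⁻¹ := by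
    obtain ⟨k, rfl⟩ : ∃ k, M = k + 1 := ⟨M - 1, by omega⟩
    rw [harmonic_succ, Nat.add_sub_cancel]
  rw [h3] at h2
  push_cast at h2
  rw [e, abs_le, one_div]
  have : (0 : ℝ) ≤ (M : ℝ)⁻¹ := by positivity
  constructor <;> linarith

/-- The first cell, at the origin where `cotRegInt` tends to `0`, costs `6h + 4h`; every further
cell costs `8h²`. -/
theorem abs_sum_cotReg_sub_le {m M : ℕ} (hM : 0 < M) (hMm : 2 * M ≤ m) :
    |Real.pi / m * ∑ n ∈ Ioo 0 (M + 1), cotReg (Real.pi / m * n) -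
      cotRegInt (Real.pi / m * M)| ≤ Real.pi / m * (10 + 8 * (Real.pi / m * M)) := by
  obtain ⟨h0, hh⟩ := pi_div_natCast_le (show 2 ≤ m by omega)
  set h := Real.pi / m with hdef
  induction M, hM using Nat.le_induction with
  | base =>
    have h1 := abs_cotReg_le h0 hh
    have h2 := abs_cotRegInt_le h0 hh
    have h3 : |h * cotReg h| ≤ h * 6 := by rw [abs_mul, abs_of_pos h0]; gcongr
    simp only [sum_Ioo_succ _ one_pos, show Ioo 0 1 = (∅ : Finset ℕ) from rfl, Finset.sum_empty,
      zero_add, Nat.cast_one, mul_one, Nat.succ_eq_add_one]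
    refine (abs_sub _ _).trans ?_
    nlinarith
  | succ M hM ih =>
    have ih := ih (by omega)
    obtain ⟨hx0, hx⟩ := pi_div_mul_mem hM (show 2 * M ≤ m by omega)
    obtain ⟨hy0, hy⟩ := pi_div_mul_mem M.succ_pos hMm
    rw [← hdef] at hx0 hx hy0 hy
    have e : h * ((M + 1 : ℕ) : ℝ) - h * M = h := by push_cast; ring
    have h1 := abs_cotRegInt_sub_mul_le hx0 (show h * M ≤ h * (M + 1 : ℕ) by linarith) hy
    rw [e] at h1
    rw [sum_Ioo_succ _ M.succ_pos, mul_add]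
    have e2 : h * ∑ n ∈ Ioo 0 (M + 1), cotReg (h * n) + h * cotReg (h * (M + 1 : ℕ)) -
        cotRegInt (h * (M + 1 : ℕ)) =
        (h * ∑ n ∈ Ioo 0 (M + 1), cotReg (h * n) - cotRegInt (h * M)) +
        (h * cotReg (h * (M + 1 : ℕ)) - (cotRegInt (h * (M + 1 : ℕ)) - cotRegInt (h * M))) := by
      ring
    refine (congrArg _ e2).trans_le ((abs_add_le _ _).trans ((add_le_add ih h1).trans_eq ?_))
    push_cast
    ring

/-- The shifted argument `log (m / π) + γ - πi / 2`. -/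
def halfArg (m : ℕ) : ℂ :=
  (Real.log (m / Real.pi) : ℂ) + (Real.eulerMascheroniConstant : ℂ)
    - (Real.pi : ℂ) * Complex.I / 2

theorem sum_inv_qInt_rootQ {m M : ℕ} (hM : 2 * M ≤ m + 2) :
    ∑ n ∈ Ioo 0 M, (qInt (rootQ m) n)⁻¹ = kap (Real.pi / m) *
      (((∑ n ∈ Ioo 0 M, (n : ℝ)⁻¹ + Real.pi / m * ∑ n ∈ Ioo 0 M, cotReg (Real.pi / m * n) : ℝ) : ℂ)
        - ((Real.pi / m * (M - 1 : ℕ) : ℝ) : ℂ) * Complex.I) := by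
  have e : ∑ n ∈ Ioo 0 M, (qInt (rootQ m) n)⁻¹ = ∑ n ∈ Ioo 0 M, kap (Real.pi / m) * ((n : ℂ)⁻¹ +
      ((Real.pi / m : ℝ) : ℂ) * ((cotReg (Real.pi / m * n) : ℂ) - Complex.I)) := by
    refine Finset.sum_congr rfl fun n hn => ?_
    rw [Finset.mem_Ioo] at hn
    exact inv_qInt_rootQ hn.1 (by omega)
  rw [e, ← Finset.mul_sum, Finset.sum_add_distrib, ← Finset.mul_sum, Finset.sum_sub_distrib,
    Finset.sum_const, Nat.card_Ioo, nsmul_eq_mul, Nat.sub_zero]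
  simp only [Complex.ofReal_add, Complex.ofReal_mul, Complex.ofReal_sum, Complex.ofReal_inv,
    Complex.ofReal_natCast]
  ring

/-- The three pieces tend to `log (m / 2) + γ`, `log (2 / π)` and `π / 2`, each with error `O(h)`.
Replacing `kap h` by `1` costs `O(h)` times a sum of logarithmic size, hence the factor `lam m`. -/
theorem exists_norm_sum_inv_qInt_sub_le :
    ∃ K : ℝ, 0 ≤ K ∧ ∀ m M : ℕ, 2 ≤ m → m ≤ 2 * M → 2 * M ≤ m + 2 →
      ‖∑ n ∈ Ioo 0 M, (qInt (rootQ m) n)⁻¹ - halfArg m‖ ≤ K * lam m / m := by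
  -- `1120 = 4 · 280`, where `280 = 3 · 81 + 37` collects the bounds `hk`, `hX2` and `hX`, and `h ≤
  -- 4 / m`.
  refine ⟨1120, by norm_num, fun m M hm hM1 hM2 => ?_⟩
  obtain ⟨h0, hh⟩ := pi_div_natCast_le hm
  have hm' : (2 : ℝ) ≤ m := by exact_mod_cast hm
  have hM0 : 0 < M := by omega
  have hM' : (0 : ℝ) < M := by exact_mod_cast hM0
  have hM1' : (m : ℝ) ≤ 2 * M := by exact_mod_cast hM1
  have hM2' : (2 : ℝ) * M ≤ m + 2 := by exact_mod_cast hM2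
  have hpi := Real.pi_pos
  have hpi3 := Real.pi_gt_three
  have hpi4 := Real.pi_le_four
  have hlm := one_le_lam m
  rw [sum_inv_qInt_rootQ hM2]
  have hhm : Real.pi / m * m = Real.pi := by field_simp
  have hh4 : Real.pi / m ≤ 4 / m := by gcongr
  have h1m : 3 * (1 / (m : ℝ)) ≤ Real.pi / m := by
    rw [mul_one_div]; gcongr
  have hk := norm_kap_sub_one_le h0 hh
  set h := Real.pi / m with hdef
  set S₁ := ∑ n ∈ Ioo 0 M, (n : ℝ)⁻¹ with hS₁
  set S₂ := h * ∑ n ∈ Ioo 0 M, cotReg (h * n) with hS₂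
  set S₃ := h * ((M - 1 : ℕ) : ℝ) with hS₃
  have hcast : ((M - 1 : ℕ) : ℝ) = M - 1 := by rw [Nat.cast_sub hM0, Nat.cast_one]
  have b3 : |S₃ - Real.pi / 2| ≤ h := by
    rw [hS₃, hcast, abs_le]
    constructor <;> nlinarith
  have b1 : |S₁ - (Real.log (m / 2) + Real.eulerMascheroniConstant)| ≤ 2 * h := by
    have a1 := abs_sum_Ioo_inv_sub_le hM0
    have a2 : 1 / (M : ℝ) ≤ 2 * (1 / m) := by
      rw [mul_one_div, div_le_div_iff₀ hM' (by linarith)]; linarith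
    have a3 : |Real.log M - Real.log (m / 2)| ≤ 2 * (1 / m) := by
      rw [← Real.log_div hM'.ne' (by positivity)]
      have a4 : 1 ≤ (M : ℝ) / (m / 2) := by rw [le_div_iff₀ (by positivity)]; linarith
      have a5 : (M : ℝ) / (m / 2) ≤ 1 + 2 * (1 / m) := by
        rw [div_le_iff₀ (by positivity)]
        have : (1 + 2 * (1 / (m : ℝ))) * (m / 2) = m / 2 + 1 := by field_simp
        linarith
      rw [abs_of_nonneg (Real.log_nonneg a4)]
      have := Real.log_le_sub_one_of_pos (show 0 < (M : ℝ) / (m / 2) by positivity)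
      linarith
    have a6 : S₁ - (Real.log (m / 2) + Real.eulerMascheroniConstant) =
        (S₁ - (Real.log M + Real.eulerMascheroniConstant)) +
          (Real.log M - Real.log (m / 2)) := by ring
    rw [a6]
    refine (abs_add_le _ _).trans ?_
    linarith
  have b2 : |S₂ - Real.log (2 / Real.pi)| ≤ 34 * h := by
    rcases Nat.lt_or_ge 1 M with hM | hM
    · obtain ⟨N, rfl⟩ : ∃ N, M = N + 1 := ⟨M - 1, by omega⟩
      have hN : 0 < N := by omega
      have a1 := abs_sum_cotReg_sub_le hN (show 2 * N ≤ m by omega)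
      obtain ⟨hx0, hx⟩ := pi_div_mul_mem hN (show 2 * N ≤ m by omega)
      rw [← hdef] at a1 hx0 hx
      have a2 := abs_cotRegInt_sub_le (by positivity) le_rfl hx0 hx
      rw [cotRegInt_pi_div_two] at a2
      have a3 : |h * N - Real.pi / 2| ≤ h := by simpa [hS₃] using b3
      have a4 : S₂ - Real.log (2 / Real.pi) =
          (S₂ - cotRegInt (h * N)) + (cotRegInt (h * N) - Real.log (2 / Real.pi)) := by ring
      rw [a4]
      refine (abs_add_le _ _).trans ?_
      have a5 : h * (10 + 8 * (h * N)) ≤ h * 26 := by gcongr; linarith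
      linarith
    -- Here the Riemann sum is empty and `m = 2`, so `h = π / 2` is large enough to absorb the
    -- constant.
    · have hM1 : M = 1 := by omega
      have hm2 : m = 2 := by omega
      have e1 : S₂ = 0 := by
        rw [hS₂, hM1, show Ioo 0 1 = (∅ : Finset ℕ) from rfl]; simp
      rw [e1, zero_sub, abs_neg, ← cotRegInt_pi_div_two]
      have hh2 : h = Real.pi / 2 := by rw [hdef, hm2]; norm_num
      have := abs_cotRegInt_le (x := Real.pi / 2) (by positivity) le_rfl
      rw [hh2]
      linarith
  have hT : halfArg m = ((Real.log (m / 2) + Real.eulerMascheroniConstant +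
      Real.log (2 / Real.pi) : ℝ) : ℂ) - ((Real.pi / 2 : ℝ) : ℂ) * Complex.I := by
    have : Real.log (m / Real.pi) = Real.log (m / 2) + Real.log (2 / Real.pi) := by
      rw [← Real.log_mul (by positivity) (by positivity)]
      congr 1; field_simp
    rw [halfArg, this]
    push_cast
    ring
  have hX : ‖((S₁ + S₂ : ℝ) : ℂ) - (S₃ : ℂ) * Complex.I - halfArg m‖ ≤ 37 * h := by
    have e : ((S₁ + S₂ : ℝ) : ℂ) - (S₃ : ℂ) * Complex.I - halfArg m =
        (((S₁ - (Real.log (m / 2) + Real.eulerMascheroniConstant)) +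
          (S₂ - Real.log (2 / Real.pi)) : ℝ) : ℂ) -
          ((S₃ - Real.pi / 2 : ℝ) : ℂ) * Complex.I := by
      rw [hT]; push_cast; ring
    rw [e]
    refine (norm_sub_le _ _).trans ?_
    rw [norm_mul, Complex.norm_I, mul_one, Complex.norm_real, Complex.norm_real]
    have := abs_add_le (S₁ - (Real.log (m / 2) + Real.eulerMascheroniConstant))
      (S₂ - Real.log (2 / Real.pi))
    simp only [Real.norm_eq_abs]
    linarith
  have hX2 : ‖((S₁ + S₂ : ℝ) : ℂ) - (S₃ : ℂ) * Complex.I‖ ≤ 81 * lam m := by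
    have c1 : |S₁| ≤ lam m := by
      rw [abs_of_nonneg (Finset.sum_nonneg fun i _ => by positivity)]
      exact (sum_Ioo_inv_le M).trans (lam_mono (by omega))
    have c2 : |S₂| ≤ 76 := by
      have : |Real.log (2 / Real.pi)| ≤ 4 * (Real.pi / 2) := by
        rw [← cotRegInt_pi_div_two]
        exact abs_cotRegInt_le (by positivity) le_rfl
      have := abs_sub_abs_le_abs_sub S₂ (Real.log (2 / Real.pi))
      linarith
    have c3 : |S₃| ≤ 4 := by
      have := abs_sub_abs_le_abs_sub S₃ (Real.pi / 2)
      rw [abs_of_pos (by positivity : 0 < Real.pi / 2)] at this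
      linarith
    refine (norm_sub_le _ _).trans ?_
    rw [norm_mul, Complex.norm_I, mul_one, Complex.norm_real, Complex.norm_real]
    have := abs_add_le S₁ S₂
    simp only [Real.norm_eq_abs]
    linarith
  have e : kap h * (((S₁ + S₂ : ℝ) : ℂ) - (S₃ : ℂ) * Complex.I) - halfArg m =
      (kap h - 1) * (((S₁ + S₂ : ℝ) : ℂ) - (S₃ : ℂ) * Complex.I) +
        (((S₁ + S₂ : ℝ) : ℂ) - (S₃ : ℂ) * Complex.I - halfArg m) := by ring
  rw [e]
  refine (norm_add_le _ _).trans ?_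
  rw [norm_mul]
  have hl1 : h ≤ h * lam m := le_mul_of_one_le_right h0.le hlm
  calc _ ≤ 3 * h * (81 * lam m) + 37 * h := by gcongr
    _ ≤ 280 * (h * lam m) := by linarith
    _ = 280 * h * lam m := by ring
    _ ≤ 280 * (4 / m) * lam m := by gcongr
    _ = 1120 * lam m / m := by ring

/-! ### Calculus of the error scale -/

/-- The error scale `log ^ J m / m`. -/
def errScale (J : ℕ) (m : ℕ) : ℝ := Real.log m ^ J / (m : ℝ)

/-- The argument `log m + γ`. -/
def logArg (m : ℕ) : ℂ := (Real.log m : ℂ) + (Real.eulerMascheroniConstant : ℂ)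

theorem lam_le_three_mul_log {m : ℕ} (hm : 2 ≤ m) : lam m ≤ 3 * Real.log m := by
  have h1 : Real.log 2 ≤ Real.log m :=
    Real.log_le_log two_pos (by exact_mod_cast hm)
  have := Real.log_two_gt_d9
  unfold lam
  linarith

theorem isBigO_errScale {f : ℕ → ℂ} {K : ℝ} {J : ℕ} (hK : 0 ≤ K)
    (h : ∀ m, 2 ≤ m → ‖f m‖ ≤ K * lam m ^ J / m) : f =O[atTop] errScale J := by
  refine IsBigO.of_bound (K * 3 ^ J) ?_
  filter_upwards [eventually_ge_atTop 2] with m hm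
  have h1 := pow_le_pow_left₀ (lam_pos m).le (lam_le_three_mul_log hm) J
  have h0 : 0 ≤ Real.log m := Real.log_natCast_nonneg m
  refine (h m hm).trans ?_
  rw [Real.norm_of_nonneg (by unfold errScale; positivity), errScale]
  calc _ ≤ K * (3 * Real.log m) ^ J / m := by gcongr
    _ = _ := by rw [mul_pow]; ring

theorem isBigO_logPow {f : ℕ → ℂ} {K : ℝ} {r : ℕ} (hK : 0 ≤ K)
    (h : ∀ m, 2 ≤ m → ‖f m‖ ≤ K * lam m ^ r) :
    f =O[atTop] fun m : ℕ => Real.log m ^ r := by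
  refine IsBigO.of_bound (K * 3 ^ r) ?_
  filter_upwards [eventually_ge_atTop 2] with m hm
  have h1 := pow_le_pow_left₀ (lam_pos m).le (lam_le_three_mul_log hm) r
  have h0 : 0 ≤ Real.log m := Real.log_natCast_nonneg m
  refine (h m hm).trans ?_
  rw [Real.norm_of_nonneg (by positivity), mul_assoc, ← mul_pow]
  gcongr

theorem logPow_isBigO_of_le {r s : ℕ} (h : r ≤ s) :
    (fun m : ℕ => Real.log m ^ r) =O[atTop] fun m : ℕ => Real.log m ^ s := by
  refine IsBigO.of_bound 1 ?_
  filter_upwards [eventually_ge_atTop 3] with m hm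
  have h1 : 1 ≤ Real.log m := by
    rw [Real.le_log_iff_exp_le (by positivity)]
    have : (3 : ℝ) ≤ m := by exact_mod_cast hm
    linarith [Real.exp_one_lt_d9]
  rw [one_mul, Real.norm_of_nonneg (by positivity), Real.norm_of_nonneg (by positivity)]
  exact pow_le_pow_right₀ h1 h

theorem errScale_isBigO_of_le {r s : ℕ} (h : r ≤ s) : errScale r =O[atTop] errScale s := by
  have := (logPow_isBigO_of_le h).mul (isBigO_refl (fun m : ℕ => (m : ℝ)⁻¹) atTop)
  refine this.congr (fun m => ?_) fun m => ?_ <;> rw [errScale, div_eq_mul_inv]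

theorem tendsto_errScale (J : ℕ) : Tendsto (errScale J) atTop (𝓝 0) := by
  have h := (Real.tendsto_pow_log_div_mul_add_atTop 1 0 J one_ne_zero).comp
    (tendsto_natCast_atTop_atTop (R := ℝ))
  refine h.congr fun m => ?_
  simp [errScale]

theorem errScale_isBigO_logPow (J r : ℕ) :
    errScale J =O[atTop] fun m : ℕ => Real.log m ^ r := by
  have h := (tendsto_errScale J).isBigO_one ℝ
  refine h.trans ?_
  simpa using logPow_isBigO_of_le (Nat.zero_le r)

theorem isBigO_mul_errScale {f e : ℕ → ℂ} {r J : ℕ}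
    (hf : f =O[atTop] fun m : ℕ => Real.log m ^ r) (he : e =O[atTop] errScale J) :
    (fun m => f m * e m) =O[atTop] errScale (J + r) := by
  refine (hf.mul he).congr_right fun m => ?_
  rw [errScale, errScale, pow_add]
  ring

/-- `f₁ f₂ - p₁ p₂ = f₁ (f₂ - p₂) + p₂ (f₁ - p₁)`, and `p₂` inherits the logarithmic bound of `f₂`.
-/
theorem isBigO_mul_sub_mul {f₁ f₂ p₁ p₂ : ℕ → ℂ} {r₁ r₂ J : ℕ}
    (h₁ : f₁ =O[atTop] fun m : ℕ => Real.log m ^ r₁)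
    (h₂ : f₂ =O[atTop] fun m : ℕ => Real.log m ^ r₂)
    (e₁ : (fun m => f₁ m - p₁ m) =O[atTop] errScale J)
    (e₂ : (fun m => f₂ m - p₂ m) =O[atTop] errScale J) :
    (fun m => f₁ m * f₂ m - p₁ m * p₂ m) =O[atTop] errScale (J + r₁ + r₂) := by
  have hp : p₂ =O[atTop] fun m : ℕ => Real.log m ^ r₂ := by
    refine (h₂.sub (e₂.trans (errScale_isBigO_logPow J r₂))).congr_left fun m => ?_
    ring
  have a₁ := (isBigO_mul_errScale h₁ e₂).trans
    (errScale_isBigO_of_le (show J + r₁ ≤ J + r₁ + r₂ by omega))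
  have a₂ := (isBigO_mul_errScale hp e₁).trans
    (errScale_isBigO_of_le (show J + r₂ ≤ J + r₁ + r₂ by omega))
  refine (a₁.add a₂).congr_left fun m => ?_
  ring

/-! ### Joint regularization of truncated sums and half sums -/

/-- `f` and `g` have the same asymptotic polynomial, in `log m + γ` and in
`log (m / π) + γ - πi / 2` respectively. -/
def JointReg (J : ℕ) (f g : ℕ → ℂ) : Prop :=
  ∃ P : Polynomial ℂ, (fun m => f m - P.eval (logArg m)) =O[atTop] errScale J ∧
    (fun m => g m - P.eval (halfArg m)) =O[atTop] errScale J

theorem JointReg.mono {J J' : ℕ} {f g : ℕ → ℂ} (h : JointReg J f g) (hJ : J ≤ J') :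
    JointReg J' f g := by
  obtain ⟨P, h₁, h₂⟩ := h
  exact ⟨P, h₁.trans (errScale_isBigO_of_le hJ), h₂.trans (errScale_isBigO_of_le hJ)⟩

theorem JointReg.zero (J : ℕ) : JointReg J (fun _ => 0) fun _ => 0 :=
  ⟨0, by simpa using isBigO_zero _ _, by simpa using isBigO_zero _ _⟩

theorem JointReg.add {J : ℕ} {f g f' g' : ℕ → ℂ} (h : JointReg J f g) (h' : JointReg J f' g') :
    JointReg J (fun m => f m + f' m) fun m => g m + g' m := by
  obtain ⟨P, h₁, h₂⟩ := h
  obtain ⟨P', h₁', h₂'⟩ := h'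
  refine ⟨P + P', (h₁.add h₁').congr_left fun m => ?_, (h₂.add h₂').congr_left fun m => ?_⟩ <;>
  · rw [Polynomial.eval_add]; ring

theorem JointReg.const_mul {J : ℕ} {f g : ℕ → ℂ} (h : JointReg J f g) (c : ℂ) :
    JointReg J (fun m => c * f m) fun m => c * g m := by
  obtain ⟨P, h₁, h₂⟩ := h
  refine ⟨Polynomial.C c * P, (h₁.const_mul_left c).congr_left fun m => ?_,
    (h₂.const_mul_left c).congr_left fun m => ?_⟩ <;>
  · rw [Polynomial.eval_mul, Polynomial.eval_C]; ring

theorem JointReg.list_sum {J : ℕ} {α : Type*} (l : List α) (f g : α → ℕ → ℂ)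
    (h : ∀ v ∈ l, JointReg J (f v) (g v)) :
    JointReg J (fun m => (l.map fun v => f v m).sum) fun m => (l.map fun v => g v m).sum := by
  induction l with
  | nil => simpa using JointReg.zero J
  | cons v l ih =>
    simp only [List.map_cons, List.sum_cons]
    exact (h v (by simp)).add (ih fun v' hv' => h v' (by simp [hv']))

theorem JointReg.mul {J r r' : ℕ} {f g f' g' : ℕ → ℂ} (h : JointReg J f g)
    (h' : JointReg J f' g')
    (hf : f =O[atTop] fun m : ℕ => Real.log m ^ r)
    (hf' : f' =O[atTop] fun m : ℕ => Real.log m ^ r')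
    (hg : g =O[atTop] fun m : ℕ => Real.log m ^ r)
    (hg' : g' =O[atTop] fun m : ℕ => Real.log m ^ r') :
    JointReg (J + r + r') (fun m => f m * f' m) fun m => g m * g' m := by
  obtain ⟨P, h₁, h₂⟩ := h
  obtain ⟨P', h₁', h₂'⟩ := h'
  refine ⟨P * P', ?_, ?_⟩
  · simpa only [Polynomial.eval_mul] using isBigO_mul_sub_mul hf hf' h₁ h₁'
  · simpa only [Polynomial.eval_mul] using isBigO_mul_sub_mul hg hg' h₂ h₂'

/-- `M m` is close to `m / 2`. -/
def IsHalf (M : ℕ → ℕ) : Prop := ∀ m, m ≤ 2 * M m ∧ 2 * M m ≤ m + 2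

/-- The part of the harmonic `q`-sum at `q = e ^ (2πi / m)` with all indices below `M m`. -/
def halfSum (M : ℕ → ℕ) (w : Index) (m : ℕ) : ℂ := nestedSum (qInt (rootQ m)) w (M m)

theorem truncL_isBigO {w : Index} (hw : Valid w) :
    truncL w =O[atTop] fun m : ℕ => Real.log m ^ w.length :=
  isBigO_logPow zero_le_one fun m _ => by simpa using norm_truncL_le hw m

theorem halfSum_isBigO {M : ℕ → ℕ} (hM : IsHalf M) {w : Index} (hw : Valid w) :
    halfSum M w =O[atTop] fun m : ℕ => Real.log m ^ w.length := by
  refine isBigO_logPow (K := (1 + 140) ^ (w.map Prod.snd).sum) (by positivity) fun m hm => ?_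
  refine ((approx_qInt_rootQ m).norm_nestedSum_le (by norm_num) hw (hM m).2).trans ?_
  have := lam_pos (M m)
  have hMm : M m ≤ m := by have := (hM m).2; omega
  gcongr
  exact lam_mono hMm

theorem jointReg_one {M : ℕ → ℕ} (hM : IsHalf M) :
    JointReg 1 (truncL [(1, 1)]) (halfSum M [(1, 1)]) := by
  refine ⟨Polynomial.X, ?_, ?_⟩
  · refine isBigO_errScale zero_le_one fun m hm => ?_
    have h := abs_sum_Ioo_inv_sub_le (show 0 < m by omega)
    have e : truncL [(1, 1)] m - Polynomial.X.eval (logArg m) =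
        ((∑ i ∈ Ioo 0 m, (i : ℝ)⁻¹ -
          (Real.log m + Real.eulerMascheroniConstant) : ℝ) : ℂ) := by
      simp [truncL, nestedSum, logArg]
    rw [e, Complex.norm_real, pow_one, one_mul]
    refine h.trans ?_
    have := one_le_lam m
    gcongr
  · obtain ⟨K, hK, h⟩ := exists_norm_sum_inv_qInt_sub_le
    refine isBigO_errScale hK fun m hm => ?_
    have e : halfSum M [(1, 1)] m = ∑ n ∈ Ioo 0 (M m), (qInt (rootQ m) n)⁻¹ := by
      simp [halfSum, nestedSum]
    rw [e, Polynomial.eval_X, pow_one]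
    exact h m (M m) hm (hM m).1 (hM m).2

/-- The polynomial is the constant limit of the truncated sums. The half sum is compared with
`truncL w (M m)`, which is as close to the limit as needed since `M m ≥ m / 2`. -/
theorem jointReg_of_admissible {M : ℕ → ℕ} (hM : IsHalf M) {w : Index} (hw : Valid w)
    (ha : Admissible w) : JointReg w.length (truncL w) (halfSum M w) := by
  obtain ⟨c, K, hK, hc⟩ := exists_truncL_limit hw ha
  obtain ⟨K', hK', hc'⟩ := exists_closeStrong 140 (by norm_num) hw ha
  refine ⟨Polynomial.C c, isBigO_errScale hK fun m hm => ?_,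
    isBigO_errScale (K := K' + 2 * K) (by positivity) fun m hm => ?_⟩
  · rw [Polynomial.eval_C]
    exact hc m (by omega)
  · obtain ⟨hM1, hM2⟩ := hM m
    have h1 := hc' m _ (approx_qInt_rootQ m) (M m) (by omega) hM2
    have h2 := hc (M m) (by omega)
    have hM0 : (0 : ℝ) < M m := by exact_mod_cast (by omega : 0 < M m)
    have hm0 : (0 : ℝ) < m := by exact_mod_cast (by omega : 0 < m)
    have hM1' : (m : ℝ) ≤ 2 * M m := by exact_mod_cast hM1
    have hl := lam_pos (M m)
    have hlm := lam_pos m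
    rw [Polynomial.eval_C]
    calc ‖halfSum M w m - c‖ = ‖(halfSum M w m - truncL w (M m)) + (truncL w (M m) - c)‖ := by
          rw [sub_add_sub_cancel]
      _ ≤ K' * lam m ^ w.length / m + K * lam (M m) ^ w.length / M m :=
          (norm_add_le _ _).trans (add_le_add h1 h2)
      _ ≤ K' * lam m ^ w.length / m + K * lam m ^ w.length / (m / 2) := by
          have := lam_mono (show M m ≤ m by omega)
          gcongr
          linarith
      _ = _ := by field_simp

/-! ### Removing leading letters `(1, 1)` -/

/-- The index has at most `a` leading letters `(1, 1)`. -/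
def LeadLE (a : ℕ) (w : Index) : Prop :=
  ∃ i ≤ a, ∃ v, Admissible v ∧ w = List.replicate i (1, 1) ++ v

theorem leadLE_cons_one {a : ℕ} {w : Index} (h : LeadLE a w) : LeadLE (a + 1) ((1, 1) :: w) := by
  obtain ⟨i, hi, v, hv, rfl⟩ := h
  exact ⟨i + 1, by omega, v, hv, by simp [List.replicate_succ]⟩

theorem leadLE_of_admissible {w : Index} (h : Admissible w) (a : ℕ) : LeadLE a w :=
  ⟨0, Nat.zero_le a, w, h, by simp⟩

theorem leadLE_length (w : Index) : LeadLE w.length w := by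
  induction w with
  | nil => exact leadLE_of_admissible (by simp [Admissible]) _
  | cons p w ih =>
    by_cases hp : p = (1, 1)
    · subst hp
      exact leadLE_cons_one ih
    · exact leadLE_of_admissible (by simpa [Admissible] using hp) _

theorem mem_stuffleOne {w v : Index} (hw : Valid w) (hv : v ∈ stuffleOne w) :
    Valid v ∧ v.length ≤ w.length + 1 := by
  induction w generalizing v with
  | nil =>
    simp only [stuffleOne, List.mem_singleton] at hv
    subst hv
    simp [Valid]
  | cons p w ih =>
    obtain ⟨η, k⟩ := p
    have hw' := valid_cons.1 hw
    simp only [stuffleOne, List.mem_cons, List.mem_map] at hv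
    rcases hv with rfl | rfl | ⟨u, hu, rfl⟩
    · exact ⟨valid_cons.2 ⟨by simp, hw⟩, by simp⟩
    · exact ⟨valid_cons.2 ⟨⟨hw'.1.1, Nat.succ_pos _⟩, hw'.2⟩, by simp⟩
    · obtain ⟨h1, h2⟩ := ih hw'.2 hu
      exact ⟨valid_cons.2 ⟨hw'.1, h1⟩, by simpa using h2⟩

/-- Inserting `(1, 1)` into or next to the leading run of `a` ones can be done at `a + 1` places,
always with the same result. A merger breaks the run, and an insertion further right does not
lengthen it. `F` is quantified after `rest` so that one decomposition serves both kinds of sums. -/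
theorem exists_stuffleOne_sum (a : ℕ) {v : Index} (hv : Valid v) (hva : Admissible v) :
    ∃ rest : List Index, (∀ u ∈ rest, Valid u ∧ u.length ≤ v.length + a + 1 ∧ LeadLE a u) ∧
      ∀ F : Index → ℂ, ((stuffleOne (List.replicate a (1, 1) ++ v)).map F).sum =
        (a + 1) * F (List.replicate (a + 1) (1, 1) ++ v) + (rest.map F).sum := by
  induction a with
  | zero =>
    match v, hv, hva with
    | [], _, _ => exact ⟨[], by simp, fun F => by simp [stuffleOne]⟩
    | (η, k) :: v, hv, hva =>
      have hv' := valid_cons.1 hv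
      refine ⟨((η, k + 1) :: v) :: (stuffleOne v).map ((η, k) :: ·), ?_, fun F => ?_⟩
      · intro u hu
        rw [List.mem_cons, List.mem_map] at hu
        rcases hu with rfl | ⟨u, hu, rfl⟩
        · refine ⟨valid_cons.2 ⟨⟨hv'.1.1, Nat.succ_pos _⟩, hv'.2⟩, by simp,
            leadLE_of_admissible ?_ _⟩
          have : 0 < k := hv'.1.2
          simp [Admissible]
          omega
        · obtain ⟨h1, h2⟩ := mem_stuffleOne hv'.2 hu
          refine ⟨valid_cons.2 ⟨hv'.1, h1⟩, by simpa using h2, leadLE_of_admissible ?_ _⟩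
          simpa [Admissible] using hva
      · simp [stuffleOne]
  | succ a ih =>
    obtain ⟨rest, hrest, hF⟩ := ih
    have hone : ‖((1 : ℂ), 1).1‖ = 1 ∧ 0 < ((1 : ℂ), 1).2 := by simp
    have hrep : Valid (List.replicate a (1, 1) ++ v) := by
      intro p hp
      rcases List.mem_append.1 hp with h | h
      · rw [List.eq_of_mem_replicate h]; simp
      · exact hv p h
    refine ⟨((1, 2) :: (List.replicate a (1, 1) ++ v)) :: rest.map ((1, 1) :: ·), ?_, fun F => ?_⟩
    · intro u hu
      rw [List.mem_cons, List.mem_map] at hu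
      rcases hu with rfl | ⟨u, hu, rfl⟩
      · refine ⟨valid_cons.2 ⟨by simp, hrep⟩, by simp; omega, leadLE_of_admissible ?_ _⟩
        simp [Admissible]
      · obtain ⟨h1, h2, h3⟩ := hrest u hu
        exact ⟨valid_cons.2 ⟨by simp, h1⟩, by simp; omega, leadLE_cons_one h3⟩
    · have := hF fun u => F ((1, 1) :: u)
      rw [List.replicate_succ, List.cons_append, stuffleOne]
      simp only [List.map_cons, List.sum_cons, List.map_map, Function.comp_def, this]
      simp only [List.replicate_succ, List.cons_append]
      push_cast
      ring

/-- The product relation is solved for the word with `a + 1` leading ones: every other word in it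
has fewer. The exponent is chosen before `M` and `w`, so it does not see the roots of unity. -/
theorem exists_jointReg (a ℓ : ℕ) :
    ∃ J, ∀ M, IsHalf M → ∀ w, Valid w → w.length ≤ ℓ → LeadLE a w →
      JointReg J (truncL w) (halfSum M w) := by
  induction a generalizing ℓ with
  | zero =>
    refine ⟨ℓ, fun M hM w hw hl ha => ?_⟩
    obtain ⟨i, hi, v, hv, rfl⟩ := ha
    obtain rfl : i = 0 := by omega
    exact (jointReg_of_admissible hM hw (by simpa using hv)).mono hl
  | succ a ih =>
    obtain ⟨J, hJ⟩ := ih ℓ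
    -- `J + 1` covers both factors of the product, the letter `(1, 1)` needing at least `1`;
    -- multiplication then adds the two lengths, `1` and at most `ℓ`.
    refine ⟨(J + 1) + 1 + ℓ, fun M hM w hw hl ha => ?_⟩
    obtain ⟨i, hi, v, hv, rfl⟩ := ha
    rcases Nat.lt_or_ge a i with h | h
    swap
    · exact (hJ M hM _ hw hl ⟨i, h, v, hv, rfl⟩).mono (by omega)
    obtain rfl : i = a + 1 := by omega
    have hvv : Valid v := fun p hp => hw p (List.mem_append_right _ hp)
    have hw' : Valid (List.replicate a (1, 1) ++ v) := fun p hp => hw p (by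
      rw [List.replicate_succ, List.cons_append]; exact List.mem_cons_of_mem _ hp)
    have hlen : (List.replicate a ((1 : ℂ), 1) ++ v).length + 1 ≤ ℓ := by
      simp only [List.length_append, List.length_replicate] at hl ⊢; omega
    have hone : Valid [(1, 1)] := by simp [Valid]
    obtain ⟨rest, hrest, hF⟩ := exists_stuffleOne_sum a hvv hv
    have hprod := JointReg.mul (r := 1) (r' := (List.replicate a ((1 : ℂ), 1) ++ v).length)
      ((jointReg_one hM).mono (show 1 ≤ J + 1 by omega))
      ((hJ M hM _ hw' (by omega) ⟨a, le_rfl, v, hv, rfl⟩).mono (show J ≤ J + 1 by omega))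
      (truncL_isBigO hone) (truncL_isBigO hw') (halfSum_isBigO hM hone) (halfSum_isBigO hM hw')
    have hsum := JointReg.list_sum (J := J) rest truncL (halfSum M) fun u hu => by
      obtain ⟨h1, h2, h3⟩ := hrest u hu
      refine hJ M hM u h1 (h2.trans ?_) h3
      simp only [List.length_append, List.length_replicate] at hlen; omega
    have hcomb := ((hprod.mono (show _ ≤ (J + 1) + 1 + ℓ by omega)).add
      ((hsum.mono (show J ≤ (J + 1) + 1 + ℓ by omega)).const_mul (-1))).const_mul
        ((a + 1 : ℂ)⁻¹)
    have ha0 : (a + 1 : ℂ) ≠ 0 := by exact_mod_cast Nat.succ_ne_zero a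
    have key : ∀ (b : ℕ → ℂ) (m : ℕ),
        (a + 1 : ℂ)⁻¹ * (nestedSum b [(1, 1)] m * nestedSum b (List.replicate a (1, 1) ++ v) m +
          -1 * (rest.map fun u => nestedSum b u m).sum) =
        nestedSum b (List.replicate (a + 1) (1, 1) ++ v) m := by
      intro b m
      rw [nestedSum_one_mul, hF fun u => nestedSum b u m]
      field_simp
      ring
    convert hcomb using 1
    · ext m; exact (key _ m).symm
    · ext m; exact (key _ (M m)).symm

/-! ### Uniqueness and conjugation of the regularized polynomial -/

/-- The difference of two candidates tends to zero along `log m + γ → ∞`, which a nonconstant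
polynomial cannot do. -/
theorem IsHarmonicReg.unique {w : Index} {P Q : Polynomial ℂ} (hP : IsHarmonicReg w P)
    (hQ : IsHarmonicReg w Q) : P = Q := by
  obtain ⟨J, _, hP⟩ := hP
  obtain ⟨J', _, hQ⟩ := hQ
  have h : Tendsto (fun m : ℕ => (P - Q).eval (logArg m)) atTop (𝓝 0) := by
    have h1 := (hQ.trans_tendsto (tendsto_errScale J')).sub
      (hP.trans_tendsto (tendsto_errScale J))
    rw [sub_zero] at h1
    refine h1.congr fun m => ?_
    rw [Polynomial.eval_sub, logArg]
    ring
  have hlog : Tendsto (fun m : ℕ => ‖logArg m‖) atTop atTop := by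
    have h1 : Tendsto (fun m : ℕ => Real.log m + Real.eulerMascheroniConstant) atTop atTop :=
      tendsto_atTop_add_const_right _ _
        (Real.tendsto_log_atTop.comp tendsto_natCast_atTop_atTop)
    refine tendsto_atTop_mono (fun m => ?_) h1
    rw [logArg, ← Complex.ofReal_add, Complex.norm_real]
    exact Real.le_norm_self _
  by_cases hd : 0 < (P - Q).degree
  · exact absurd (Polynomial.tendsto_norm_atTop _ hd hlog) (not_tendsto_atTop_of_tendsto_nhds
      (by simpa using h.norm))
  · rw [Polynomial.eq_C_of_degree_le_zero (not_lt.1 hd)] at h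
    simp only [Polynomial.eval_C] at h
    have h0 := tendsto_nhds_unique h tendsto_const_nhds
    rw [← sub_eq_zero, Polynomial.eq_C_of_degree_le_zero (not_lt.1 hd), ← h0, Polynomial.C_0]

theorem IsHarmonicReg.Lstar_eq {w : Index} {P : Polynomial ℂ} (hP : IsHarmonicReg w P) :
    Lstar w = P := by
  have h : ∃ P : Polynomial ℂ, IsHarmonicReg w P := ⟨P, hP⟩
  rw [Lstar, dif_pos h]
  exact h.choose_spec.unique hP

theorem JointReg.exists_isHarmonicReg {J : ℕ} {w : Index} {g : ℕ → ℂ}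
    (h : JointReg J (truncL w) g) :
    IsHarmonicReg w (Lstar w) ∧
      (fun m => g m - (Lstar w).eval (halfArg m)) =O[atTop] errScale J := by
  obtain ⟨P, h1, h2⟩ := h
  have hP : IsHarmonicReg w P :=
    ⟨J + 1, Nat.succ_pos J, h1.trans (errScale_isBigO_of_le (Nat.le_succ J))⟩
  rw [hP.Lstar_eq]
  exact ⟨hP, h2⟩

/-- The argument `log m + γ` is real, so conjugation only affects the coefficients. -/
theorem isHarmonicReg_conj {w : Index} {P : Polynomial ℂ} (h : IsHarmonicReg w P) :
    IsHarmonicReg (w.map fun p => (starRingEnd ℂ p.1, p.2)) (P.map (starRingEnd ℂ)) := by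
  obtain ⟨J, hJ, h⟩ := h
  refine ⟨J, hJ, IsBigO.congr' (f₁ := fun m => starRingEnd ℂ (truncL w m - P.eval (logArg m)))
    ?_ (Eventually.of_forall fun m => ?_) EventuallyEq.rfl⟩
  · exact IsBigO.of_norm_left (by simpa only [RCLike.norm_conj, logArg] using h.norm_left)
  · have e : (Real.log m : ℂ) + (Real.eulerMascheroniConstant : ℂ) =
        starRingEnd ℂ (logArg m) := by
      rw [logArg, map_add, Complex.conj_ofReal, Complex.conj_ofReal]
    simp only [map_sub, conj_truncL, e, Polynomial.eval_map, Polynomial.eval₂_at_apply]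

/-! ### Assembling the asymptotic formula -/

theorem isPrimitiveRoot_rootQ {m : ℕ} (hm : m ≠ 0) : IsPrimitiveRoot (rootQ m) m :=
  Complex.isPrimitiveRoot_exp m hm

theorem norm_rootQ {m : ℕ} (hm : m ≠ 0) : ‖rootQ m‖ = 1 :=
  Complex.norm_eq_one_of_pow_eq_one (isPrimitiveRoot_rootQ hm).pow_eq_one hm

theorem norm_pow_sub_one_le {q : ℂ} (hq : ‖q‖ = 1) (s : ℕ) : ‖q ^ s - 1‖ ≤ s * ‖q - 1‖ := by
  induction s with
  | zero => simp
  | succ s ih =>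
    have e : q ^ (s + 1) - 1 = q ^ s * (q - 1) + (q ^ s - 1) := by ring
    rw [e]
    refine (norm_add_le _ _).trans ?_
    rw [norm_mul, norm_pow, hq, one_pow]
    push_cast
    linarith

theorem rootQ_pow_sub_one_isBigO (s : ℕ) :
    (fun m => rootQ m ^ s - 1) =O[atTop] errScale 0 := by
  refine isBigO_errScale (K := s * (2 * Real.pi)) (by have := Real.pi_pos; positivity)
    fun m hm => ?_
  have hm0 : (0 : ℝ) < m := by exact_mod_cast (by omega : 0 < m)
  refine (norm_pow_sub_one_le (norm_rootQ (by omega)) s).trans ?_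
  have e : rootQ m = Complex.exp (Complex.I * ((2 * Real.pi / m : ℝ) : ℂ)) := by
    rw [rootQ]; congr 1; push_cast; ring
  have h : ‖rootQ m - 1‖ ≤ 2 * Real.pi / m := by
    rw [e]
    refine (Real.norm_exp_I_mul_ofReal_sub_one_le).trans_eq ?_
    have := Real.pi_pos
    exact Real.norm_of_nonneg (by positivity)
  calc _ ≤ (s : ℝ) * (2 * Real.pi / m) := by gcongr
    _ = _ := by ring

theorem isBigO_conj {f : ℕ → ℂ} {g : ℕ → ℝ} (h : f =O[atTop] g) :
    (fun m => starRingEnd ℂ (f m)) =O[atTop] g :=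
  IsBigO.of_norm_left (by simpa only [RCLike.norm_conj] using h.norm_left)

theorem conj_eval (P : Polynomial ℂ) (z : ℂ) :
    starRingEnd ℂ (P.eval z) = (P.map (starRingEnd ℂ)).eval (starRingEnd ℂ z) := by
  rw [Polynomial.eval_map, Polynomial.eval₂_at_apply]

theorem conj_halfArg (m : ℕ) : starRingEnd ℂ (halfArg m) =
    (Real.log (m / Real.pi) : ℂ) + (Real.eulerMascheroniConstant : ℂ)
      + (Real.pi : ℂ) * Complex.I / 2 := by
  rw [halfArg, map_sub, map_add, Complex.conj_ofReal, Complex.conj_ofReal, map_div₀, map_mul,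
    Complex.conj_ofReal, Complex.conj_I, map_ofNat]
  ring

theorem Valid.take {w : Index} (hw : Valid w) (j : ℕ) : Valid (w.take j) :=
  fun p hp => hw p (List.mem_of_mem_take hp)

theorem Valid.drop {w : Index} (hw : Valid w) (j : ℕ) : Valid (w.drop j) :=
  fun p hp => hw p (List.mem_of_mem_drop hp)

theorem Valid.reverse {w : Index} (hw : Valid w) : Valid w.reverse :=
  fun p hp => hw p (List.mem_reverse.1 hp)

theorem Valid.norm_prod {w : Index} (hw : Valid w) : ‖(w.map Prod.fst).prod‖ = 1 := by
  induction w with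
  | nil => simp
  | cons p w ih =>
    rw [valid_cons] at hw
    rw [List.map_cons, List.prod_cons, norm_mul, hw.1.1, ih hw.2, one_mul]

theorem mainTerm_asymptotics {J r : ℕ}
    (hJ : ∀ M, IsHalf M → ∀ w, Valid w → w.length ≤ r → JointReg J (truncL w) (halfSum M w))
    {w : Index} (hw : Valid w) (hl : w.length ≤ r) :
    (fun m => multHarmonicQSum w m (rootQ m) - mainTerm w m) =O[atTop]
      errScale (J + r + r) := by
  -- For the cut `c = m / 2 + 1` both `c` and the reflected bound `m + 1 - c` are within `1` of `m /
  -- 2`, for either parity of `m`.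
  set M : ℕ → ℕ := fun m => m / 2 + 1 with hMdef
  set M' : ℕ → ℕ := fun m => m + 1 - (m / 2 + 1) with hMdef'
  have hM : IsHalf M := fun m => by simp only [hMdef]; omega
  have hM' : IsHalf M' := fun m => by simp only [hMdef']; omega
  set A : ℕ → ℕ → ℂ := fun j m =>
    (-1 : ℂ) ^ ((w.take j).map Prod.snd).sum * ((w.take j).map Prod.fst).prod ^ m with hA
  set s : ℕ → ℕ := fun j => ((w.take j).map Prod.snd).sum with hs
  set U : ℕ → ℕ → ℂ := fun j m => starRingEnd ℂ (halfSum M' (w.take j).reverse m) with hU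
  set V : ℕ → ℕ → ℂ := fun j m => halfSum M (w.drop j) m with hV
  set P : ℕ → ℕ → ℂ := fun j m => (Lstar (conjReverse (w.take j))).eval
    (starRingEnd ℂ (halfArg m)) with hP
  set Q : ℕ → ℕ → ℂ := fun j m => (Lstar (w.drop j)).eval (halfArg m) with hQ
  -- The unimodular factor `A` is harmless. The error splits into replacing `q ^ s` by `1` and
  -- replacing the two half sums by their polynomials.
  have hterm : ∀ j ∈ range (w.length + 1), (fun m => A j m *
      ((rootQ m ^ s j - 1) * (U j m * V j m) + (U j m * V j m - P j m * Q j m)))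
      =O[atTop] errScale (J + r + r) := by
    intro j _
    have hv := (hw.take j).reverse
    have hd := hw.drop j
    have hvl : (w.take j).reverse.length ≤ r := by simp; omega
    have hdl : (w.drop j).length ≤ r := by simp; omega
    obtain ⟨hv1, hv2⟩ := (hJ M' hM' _ hv hvl).exists_isHarmonicReg
    obtain ⟨-, hd2⟩ := (hJ M hM _ hd hdl).exists_isHarmonicReg
    have hconj : Lstar (conjReverse (w.take j)) =
        (Lstar (w.take j).reverse).map (starRingEnd ℂ) := (isHarmonicReg_conj hv1).Lstar_eq
    have hUP : (fun m => U j m - P j m) =O[atTop] errScale J := by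
      refine (isBigO_conj hv2).congr_left fun m => ?_
      simp only [hU, hP]
      rw [map_sub, conj_eval, hconj]
    have hUb : U j =O[atTop] fun m : ℕ => Real.log m ^ r :=
      (isBigO_conj (halfSum_isBigO hM' hv)).trans (logPow_isBigO_of_le hvl)
    have hVb : V j =O[atTop] fun m : ℕ => Real.log m ^ r :=
      (halfSum_isBigO hM hd).trans (logPow_isBigO_of_le hdl)
    have h1 := isBigO_mul_sub_mul hUb hVb hUP hd2
    have hUV : (fun m => U j m * V j m) =O[atTop] fun m : ℕ => Real.log m ^ (r + r) :=
      (hUb.mul hVb).congr_right fun m => by rw [pow_add]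
    have h2 := (isBigO_mul_errScale hUV (rootQ_pow_sub_one_isBigO (s j))).trans
      (errScale_isBigO_of_le (show 0 + (r + r) ≤ J + r + r by omega))
    have h3 : (A j) =O[atTop] fun _ : ℕ => (1 : ℝ) := by
      refine IsBigO.of_bound 1 (Eventually.of_forall fun m => ?_)
      simp only [hA, norm_mul, norm_pow, (hw.take j).norm_prod]
      simp
    have h4 := h3.mul (h2.add h1)
    simp only [one_mul] at h4
    refine h4.congr_left fun m => ?_
    simp only [hQ]
    ring
  refine (IsBigO.sum hterm).congr' ?_ EventuallyEq.rfl
  filter_upwards [eventually_ge_atTop 2] with m hm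
  have hprim := isPrimitiveRoot_rootQ (show m ≠ 0 by omega)
  rw [multHarmonicQSum_split (c := M m) (hprim.ne_one (by omega)) hprim.pow_eq_one
    (norm_rootQ (by omega)) (by simp only [hMdef]; omega) (by simp only [hMdef]; omega) w
    fun p hp => (hw p hp).1, mainTerm, ← Finset.sum_sub_distrib, Finset.sum_apply]
  refine Finset.sum_congr rfl fun j _ => ?_
  rw [← conj_halfArg m, ← halfArg]
  simp only [hA, hU, hV, hP, hQ, hs, halfSum, hMdef, hMdef']
  ring

end ColoredMZV

end

theorem mainTheorem3 (r : ℕ) (k : Fin r → ℕ) (hk : ∀ i, 0 < k i) :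
    ∃ J : ℕ, 0 < J ∧ ∀ (N : ℕ), 0 < N → ∀ (η : Fin r → ℂ), (∀ i, η i ^ N = 1) →
      (∃! P : Polynomial ℂ, ColoredMZV.IsHarmonicReg (ColoredMZV.mkIndex η k) P) ∧
      (fun m : ℕ =>
          ColoredMZV.multHarmonicQSum (ColoredMZV.mkIndex η k) m
              (Complex.exp (2 * (Real.pi : ℂ) * Complex.I / (m : ℂ)))
            - ColoredMZV.mainTerm (ColoredMZV.mkIndex η k) m)
        =O[Filter.atTop] (fun m : ℕ => Real.log m ^ J / (m : ℝ)) := by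
  obtain ⟨J, hJ⟩ := ColoredMZV.exists_jointReg r r
  have hJ' : ∀ M, ColoredMZV.IsHalf M → ∀ w, ColoredMZV.Valid w → w.length ≤ r →
      ColoredMZV.JointReg J (ColoredMZV.truncL w) (ColoredMZV.halfSum M w) := by
    intro M hM w hw hl
    obtain ⟨i, hi, h⟩ := ColoredMZV.leadLE_length w
    exact hJ M hM w hw hl ⟨i, hi.trans hl, h⟩
  -- The two factors of each summand have length at most `r`, which adds `r + r`; the final `1`
  -- ensures positivity.
  refine ⟨J + r + r + 1, Nat.succ_pos _, fun N hN η hη => ?_⟩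
  have hw : ColoredMZV.Valid (ColoredMZV.mkIndex η k) := by
    intro p hp
    obtain ⟨i, rfl⟩ := (List.mem_ofFn' _ _).1 hp
    exact ⟨Complex.norm_eq_one_of_pow_eq_one (hη i) hN.ne', hk i⟩
  have hl : (ColoredMZV.mkIndex η k).length ≤ r := by simp [ColoredMZV.mkIndex]
  constructor
  · have h := (hJ' (fun m => m / 2 + 1) (fun m => by dsimp only; omega) _ hw hl).exists_isHarmonicReg.1
    exact ⟨_, h, fun P hP => hP.unique h⟩
  · exact (ColoredMZV.mainTerm_asymptotics hJ' hw hl).trans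
      (ColoredMZV.errScale_isBigO_of_le (Nat.le_succ _))
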